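/- Let $\mathbb{H}^4=\{(v,t): v\in\mathbb{R}^3,\ t>0\}$ be the upper half-space model of hyperbolic $4$-space, with the distance $\rho$ given by $\cosh\rho(x,\hat x)=1+\|x-\hat x\|^2/(2t\hat t)$, where $\|\cdot\|$ is the Euclidean norm of $\mathbb{R}^4$ and $t,\hat t$ are the last coordinates of $x,\hat x$, and with boundary $\partial\mathbb{H}^4=\mathbb{R}^3\cup\{\infty\}$, to which every isometry of $\mathbb{H}^4$ extends continuously. Let $\operatorname{Isom}^+(\mathbb{H}^4)$ be the group of orientation-preserving isometries of $\mathbb{H}^4$. An element $\gamma\in\operatorname{Isom}^+(\mathbb{H}^4)$ is called parabolic if it has no fixed point in $\mathbb{H}^4$ and exactly one fixed point on $\partial\mathbb{H}^4$. Every parabolic $\gamma$ is conjugate in $\operatorname{Isom}^+(\mathbb{H}^4)$ to a map of the form $(v,t)\mapsto(Av+a,t)$ with $A\in SO(3)$ and $0\neq a\in\mathbb{R}^3$, where the conjugacy class of $A$ in $SO(3)$ is uniquely determined by $\gamma$; it is called an irrational screw translation if $A$ has infinite order. **Theorem.** Let $\Gamma\subset\operatorname{Isom}^+(\mathbb{H}^4)$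 be a discrete subgroup which acts freely on $\mathbb{H}^4$ (that is, no non-identity element of $\Gamma$ has a fixed point in $\mathbb{H}^4$), and let $\Gamma_\infty=\{\gamma\in\Gamma:\gamma(\infty)=\infty\}$ be the stabilizer of $\infty\in\partial\mathbb{H}^4$ in $\Gamma$. If $\Gamma_\infty$ contains an irrational screw translation, then $\Gamma_\infty$ is an infinite cyclic group. -/

import Mathlib

/-- The upper half-space model of hyperbolic `4`-space: points `(v, t)` with `v ∈ ℝ³`, `t > 0`. -/
@[ext]
structure HypFour where
  v : EuclideanSpace ℝ (Fin 3)
  t : ℝ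
  t_pos : 0 < t

namespace HypFour

/-- `ℝ⁴` with its Euclidean norm; the last coordinate is `t`. -/
abbrev E4 : Type := EuclideanSpace ℝ (Fin 4)

/-- The inclusion of the upper half-space into `ℝ⁴`. -/
def toE4 (x : HypFour) : E4 := !₂[x.v 0, x.v 1, x.v 2, x.t]

theorem norm_sq_four (a b c d : ℝ) : ‖(!₂[a, b, c, d] : E4)‖ ^ 2 = a ^ 2 + b ^ 2 + c ^ 2 + d ^ 2 := by
  rw [EuclideanSpace.real_norm_sq_eq, Fin.sum_univ_four]
  rfl

theorem norm_sq_three (v : EuclideanSpace ℝ (Fin 3)) :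
    ‖v‖ ^ 2 = v 0 ^ 2 + v 1 ^ 2 + v 2 ^ 2 := by
  rw [EuclideanSpace.real_norm_sq_eq, Fin.sum_univ_three]

theorem norm_sq_toE4 (x : HypFour) : ‖x.toE4‖ ^ 2 = ‖x.v‖ ^ 2 + x.t ^ 2 := by
  rw [toE4, norm_sq_four, norm_sq_three]

/-- The hyperbolic distance `ρ` of the metric `dx² / t²`, given by
`cosh ρ(x, y) = 1 + ‖x - y‖² / (2 t_x t_y)`. -/
noncomputable instance : Dist HypFour :=
  ⟨fun x y => Real.arcosh (1 + ‖x.toE4 - y.toE4‖ ^ 2 / (2 * x.t * y.t))⟩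

theorem one_le_aux (x y : HypFour) : 1 ≤ 1 + ‖x.toE4 - y.toE4‖ ^ 2 / (2 * x.t * y.t) := by
  have := x.t_pos
  have := y.t_pos
  have : 0 ≤ ‖x.toE4 - y.toE4‖ ^ 2 / (2 * x.t * y.t) := by positivity
  linarith

theorem cosh_dist (x y : HypFour) :
    Real.cosh (dist x y) = 1 + ‖x.toE4 - y.toE4‖ ^ 2 / (2 * x.t * y.t) :=
  Real.cosh_arcosh (one_le_aux x y)

theorem dist_nonneg_aux (x y : HypFour) : 0 ≤ dist x y := Real.arcosh_nonneg (one_le_aux x y)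

/-- The reflection of a point of the upper half-space in `ℝ³`. -/
def refl4 (x : HypFour) : E4 := !₂[x.v 0, x.v 1, x.v 2, -x.t]

theorem norm_sq_sub (x y : HypFour) :
    ‖x.toE4 - y.toE4‖ ^ 2 = ‖x.v - y.v‖ ^ 2 + (x.t - y.t) ^ 2 := by
  rw [EuclideanSpace.real_norm_sq_eq, Fin.sum_univ_four, norm_sq_three]
  rfl

theorem norm_sq_sub_refl (x y : HypFour) :
    ‖x.toE4 - y.refl4‖ ^ 2 = ‖x.v - y.v‖ ^ 2 + (x.t + y.t) ^ 2 := by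
  rw [EuclideanSpace.real_norm_sq_eq, Fin.sum_univ_four, norm_sq_three]
  simp [toE4, refl4]

theorem sinh_half_dist (x y : HypFour) :
    Real.sinh (dist x y / 2) = ‖x.toE4 - y.toE4‖ / (2 * (√x.t * √y.t)) := by
  have hx := x.t_pos
  have hy := y.t_pos
  have h0 := dist_nonneg_aux x y
  have h1 : Real.cosh (dist x y) = 1 + 2 * Real.sinh (dist x y / 2) ^ 2 := by
    have h := Real.cosh_two_mul (dist x y / 2)
    have h' := Real.cosh_sq (dist x y / 2)
    rw [mul_div_cancel₀ _ (two_ne_zero' ℝ)] at h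
    linarith
  have h2 : 0 ≤ Real.sinh (dist x y / 2) := Real.sinh_nonneg_iff.2 (by linarith)
  rw [← sq_eq_sq₀ h2 (by positivity), div_pow, mul_pow, mul_pow, Real.sq_sqrt hx.le,
    Real.sq_sqrt hy.le]
  rw [cosh_dist] at h1
  have : ‖x.toE4 - y.toE4‖ ^ 2 / (2 ^ 2 * (x.t * y.t))
      = (‖x.toE4 - y.toE4‖ ^ 2 / (2 * x.t * y.t)) / 2 := by
    ring
  linarith

theorem cosh_half_dist (x y : HypFour) :
    Real.cosh (dist x y / 2) = ‖x.toE4 - y.refl4‖ / (2 * (√x.t * √y.t)) := by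
  have hx := x.t_pos
  have hy := y.t_pos
  rw [← sq_eq_sq₀ (Real.cosh_pos _).le (by positivity), Real.cosh_sq, sinh_half_dist, div_pow,
    div_pow, mul_pow, mul_pow, Real.sq_sqrt hx.le, Real.sq_sqrt hy.le, norm_sq_sub,
    norm_sq_sub_refl]
  field_simp
  ring

theorem dist_comm_aux (x y : HypFour) : dist x y = dist y x := by
  change Real.arcosh _ = Real.arcosh _
  rw [norm_sub_rev, mul_right_comm]

theorem refl_comm (x y : HypFour) : ‖x.toE4 - y.refl4‖ = ‖y.toE4 - x.refl4‖ := by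
  rw [← sq_eq_sq₀ (norm_nonneg _) (norm_nonneg _), norm_sq_sub_refl, norm_sq_sub_refl,
    norm_sub_rev, add_comm y.t]

theorem dist_triangle_aux (a b c : HypFour) : dist a c ≤ dist a b + dist b c := by
  have ha := a.t_pos
  have hb := b.t_pos
  have hc := c.t_pos
  have key := EuclideanGeometry.mul_dist_le_mul_dist_add_mul_dist a.toE4 b.toE4 c.toE4 b.refl4
  simp only [dist_eq_norm] at key
  have hbb : ‖b.toE4 - b.refl4‖ = 2 * b.t := by
    rw [← sq_eq_sq₀ (norm_nonneg _) (by positivity), norm_sq_sub_refl]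
    simp
    ring
  rw [hbb] at key
  suffices h : Real.sinh (dist a c / 2) ≤ Real.sinh (dist a b / 2 + dist b c / 2) by
    have := Real.sinh_le_sinh.1 h
    linarith
  rw [Real.sinh_add, sinh_half_dist, sinh_half_dist, sinh_half_dist, cosh_half_dist,
    cosh_half_dist, refl_comm b c]
  have hs : √b.t * √b.t = b.t := Real.mul_self_sqrt hb.le
  have : ‖a.toE4 - b.toE4‖ / (2 * (√a.t * √b.t)) * (‖c.toE4 - b.refl4‖ / (2 * (√b.t * √c.t))) +
      ‖a.toE4 - b.refl4‖ / (2 * (√a.t * √b.t)) * (‖b.toE4 - c.toE4‖ / (2 * (√b.t * √c.t)))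
      = (‖a.toE4 - b.toE4‖ * ‖c.toE4 - b.refl4‖ + ‖b.toE4 - c.toE4‖ * ‖a.toE4 - b.refl4‖) /
        (4 * b.t * (√a.t * √c.t)) := by
    have h0 : √b.t ≠ 0 := (Real.sqrt_pos.2 hb).ne'
    have h1 : √a.t ≠ 0 := (Real.sqrt_pos.2 ha).ne'
    have h2 : √c.t ≠ 0 := (Real.sqrt_pos.2 hc).ne'
    generalize √b.t = β at *
    rw [← hs]
    field_simp
    ring
  rw [this, div_le_div_iff₀ (by positivity) (by positivity)]
  have h4 : 0 ≤ 2 * (√a.t * √c.t) := by positivity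
  nlinarith [mul_le_mul_of_nonneg_right key h4]

theorem eq_of_dist_eq_zero_aux (x y : HypFour) (h : dist x y = 0) : x = y := by
  have hx := x.t_pos
  have hy := y.t_pos
  have h1 := cosh_dist x y
  rw [h, Real.cosh_zero] at h1
  have h2 : ‖x.toE4 - y.toE4‖ ^ 2 / (2 * x.t * y.t) = 0 := by linarith
  have h3 : ‖x.toE4 - y.toE4‖ ^ 2 = 0 := by
    rcases div_eq_zero_iff.1 h2 with h | h
    · exact h
    · exact absurd h (by positivity)
  have h4 : x.toE4 = y.toE4 := by simpa [sub_eq_zero] using h3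
  ext1
  · ext i
    fin_cases i
    · exact congrArg (fun y : E4 => y 0) h4
    · exact congrArg (fun y : E4 => y 1) h4
    · exact congrArg (fun y : E4 => y 2) h4
  · exact congrArg (fun y : E4 => y 3) h4

noncomputable instance : MetricSpace HypFour where
  dist_self x := by
    change Real.arcosh _ = 0
    simp
  dist_comm := dist_comm_aux
  dist_triangle := dist_triangle_aux
  eq_of_dist_eq_zero {x y} := eq_of_dist_eq_zero_aux x y

/-- The isometry group carries the compact-open topology. -/
noncomputable instance : TopologicalSpace (HypFour ≃ᵢ HypFour) :=
  TopologicalSpace.induced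
    (fun γ => (⟨γ, γ.continuous⟩ : C(HypFour, HypFour))) inferInstance

open Classical in
/-- An isometry, written as a self-map of `ℝ⁴` (with value `0` outside the upper half-space). -/
noncomputable def coordMap (γ : HypFour ≃ᵢ HypFour) : E4 → E4 := fun y =>
  if h : 0 < y 3 then (γ ⟨!₂[y 0, y 1, y 2], y 3, h⟩).toE4 else 0

/-- `γ ∈ Isom⁺(ℍ⁴)`: the Jacobian determinant of `γ` is positive at every point of the upper
half-space. -/
def OrientationPreserving (γ : HypFour ≃ᵢ HypFour) : Prop :=
  ∀ x : HypFour, 0 < (fderiv ℝ (coordMap γ) x.toE4).det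

/-- The upper half-space inside the one-point compactification of `ℝ⁴`. -/
def toSphere (x : HypFour) : OnePoint E4 := (x.toE4 : OnePoint E4)

/-- The boundary `∂ℍ⁴ = ℝ³ ∪ {∞}` inside the one-point compactification of `ℝ⁴`. -/
def bdry : OnePoint (EuclideanSpace ℝ (Fin 3)) → OnePoint E4 :=
  OnePoint.map (fun v => !₂[v 0, v 1, v 2, 0])

/-- `γ(p) = p` for the continuous extension of `γ` to `∂ℍ⁴`, i.e. `γ(x) → p` as `x → p`. -/
def FixesBoundaryPoint (γ : HypFour ≃ᵢ HypFour) (p : OnePoint (EuclideanSpace ℝ (Fin 3))) :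
    Prop :=
  Filter.Tendsto (fun x => toSphere (γ x)) (Filter.comap toSphere (nhds (bdry p)))
    (nhds (bdry p))

/-- `γ` has no fixed point in `ℍ⁴` and exactly one on `∂ℍ⁴`. -/
def IsParabolic (γ : HypFour ≃ᵢ HypFour) : Prop :=
  (∀ x, γ x ≠ x) ∧ ∃! p, FixesBoundaryPoint γ p

/-- The map `(v, t) ↦ (A v + a, t)`. -/
noncomputable def normalForm (A : Matrix (Fin 3) (Fin 3) ℝ) (a : EuclideanSpace ℝ (Fin 3))
    (x : HypFour) : HypFour :=
  ⟨Matrix.toEuclideanLin A x.v + a, x.t, x.t_pos⟩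

/-- A parabolic isometry which is conjugate in `Isom⁺(ℍ⁴)` to `(v, t) ↦ (A v + a, t)`, where
`a ≠ 0` and `A ∈ SO(3)` has infinite order. -/
def IsIrrationalScrewTranslation (γ : HypFour ≃ᵢ HypFour) : Prop :=
  IsParabolic γ ∧
    ∃ h : HypFour ≃ᵢ HypFour, OrientationPreserving h ∧
      ∃ (A : Matrix.specialOrthogonalGroup (Fin 3) ℝ) (a : EuclideanSpace ℝ (Fin 3)),
        a ≠ 0 ∧ ¬ IsOfFinOrder A ∧ ∀ x, (h * γ * h⁻¹) x = normalForm (A : Matrix _ _ ℝ) a x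

/-! ### The stabilizer of `∞` -/

theorem comap_toSphere_infty :
    Filter.comap toSphere (nhds (bdry OnePoint.infty)) =
      Filter.comap (fun x : HypFour => ‖x.toE4‖) Filter.atTop := by
  have : (toSphere : HypFour → OnePoint E4) = ((↑) : E4 → OnePoint E4) ∘ toE4 := rfl
  rw [this, ← Filter.comap_comap]
  change Filter.comap toE4 (Filter.comap _ (nhds OnePoint.infty)) = _
  rw [OnePoint.comap_coe_nhds_infty, Filter.coclosedCompact_eq_cocompact,
    ← Metric.cobounded_eq_cocompact,
    ← comap_norm_atTop, Filter.comap_comap]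
  rfl

theorem fixes_infty_iff (γ : HypFour ≃ᵢ HypFour) :
    FixesBoundaryPoint γ OnePoint.infty ↔
      Filter.Tendsto (fun x => ‖(γ x).toE4‖)
        (Filter.comap (fun x : HypFour => ‖x.toE4‖) Filter.atTop) Filter.atTop := by
  have h1 : FixesBoundaryPoint γ OnePoint.infty ↔
      Filter.Tendsto γ (Filter.comap toSphere (nhds (bdry OnePoint.infty)))
        (Filter.comap toSphere (nhds (bdry OnePoint.infty))) := by
    rw [Filter.tendsto_comap_iff]
    rfl
  rw [h1, comap_toSphere_infty, Filter.tendsto_comap_iff]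
  rfl

/-- The base point `(0, 1)`. -/
noncomputable def base : HypFour := ⟨0, 1, one_pos⟩

theorem cosh_dist_base (x : HypFour) :
    Real.cosh (dist x base) = (1 + ‖x.toE4‖ ^ 2) / (2 * x.t) := by
  have hx := x.t_pos
  rw [cosh_dist, norm_sq_sub, norm_sq_toE4]
  simp only [base, sub_zero, mul_one]
  field_simp
  ring

theorem cosh_dist_base_le (γ : HypFour ≃ᵢ HypFour) (x : HypFour) :
    Real.cosh (dist (γ x) base) ≤
      2 * Real.exp (dist (γ base) base) * Real.cosh (dist x base) := by
  have h1 : dist (γ x) base ≤ dist x base + dist (γ base) base := by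
    calc _ ≤ dist (γ x) (γ base) + dist (γ base) base := dist_triangle _ _ _
      _ = _ := by rw [γ.dist_eq]
  have h2 : Real.cosh (dist (γ x) base) ≤ Real.exp (dist (γ x) base) := by
    rw [Real.cosh_eq]
    have : Real.exp (-dist (γ x) base) ≤ Real.exp (dist (γ x) base) :=
      Real.exp_le_exp.2 (by linarith [dist_nonneg (x := γ x) (y := base)])
    linarith
  have h3 : Real.exp (dist x base) ≤ 2 * Real.cosh (dist x base) := by
    rw [Real.cosh_eq]
    linarith [Real.exp_pos (-dist x base)]
  calc _ ≤ _ := h2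
    _ ≤ Real.exp (dist x base + dist (γ base) base) := Real.exp_le_exp.2 h1
    _ = Real.exp (dist (γ base) base) * Real.exp (dist x base) := by rw [Real.exp_add, mul_comm]
    _ ≤ Real.exp (dist (γ base) base) * (2 * Real.cosh (dist x base)) := by gcongr
    _ = _ := by ring

/-- Isometries are Lipschitz for the chordal metric. -/
theorem chordal_le (γ : HypFour ≃ᵢ HypFour) (x z : HypFour) :
    ‖x.toE4 - z.toE4‖ ^ 2 * ((1 + ‖(γ x).toE4‖ ^ 2) * (1 + ‖(γ z).toE4‖ ^ 2)) ≤
      (2 * Real.exp (dist (γ base) base)) ^ 2 *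
        (‖(γ x).toE4 - (γ z).toE4‖ ^ 2 * ((1 + ‖x.toE4‖ ^ 2) * (1 + ‖z.toE4‖ ^ 2))) := by
  have h1 : ‖x.toE4 - z.toE4‖ ^ 2 / (2 * x.t * z.t) =
      ‖(γ x).toE4 - (γ z).toE4‖ ^ 2 / (2 * (γ x).t * (γ z).t) := by
    have h := cosh_dist (γ x) (γ z)
    rw [γ.dist_eq, cosh_dist] at h
    linarith
  have hx := cosh_dist_base_le γ x
  have hz := cosh_dist_base_le γ z
  rw [cosh_dist_base, cosh_dist_base] at hx hz
  have p1 := x.t_pos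
  have p2 := z.t_pos
  have p3 := (γ x).t_pos
  have p4 := (γ z).t_pos
  set C := 2 * Real.exp (dist (γ base) base)
  have hC : 0 < C := by positivity
  have h2 := mul_le_mul hx hz (by positivity) (by positivity)
  have h3 := mul_le_mul_of_nonneg_left h2
    (show 0 ≤ ‖x.toE4 - z.toE4‖ ^ 2 / (2 * x.t * z.t) by positivity)
  have e : ‖x.toE4 - z.toE4‖ ^ 2 * ((1 + ‖(γ x).toE4‖ ^ 2) * (1 + ‖(γ z).toE4‖ ^ 2)) =
      (8 * x.t * z.t * (γ x).t * (γ z).t) * (‖x.toE4 - z.toE4‖ ^ 2 / (2 * x.t * z.t) *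
        ((1 + ‖(γ x).toE4‖ ^ 2) / (2 * (γ x).t) * ((1 + ‖(γ z).toE4‖ ^ 2) / (2 * (γ z).t)))) := by
    field_simp
    ring
  have e' : C ^ 2 *
      (‖(γ x).toE4 - (γ z).toE4‖ ^ 2 * ((1 + ‖x.toE4‖ ^ 2) * (1 + ‖z.toE4‖ ^ 2))) =
      (8 * x.t * z.t * (γ x).t * (γ z).t) * (‖x.toE4 - z.toE4‖ ^ 2 / (2 * x.t * z.t) *
        (C * ((1 + ‖x.toE4‖ ^ 2) / (2 * x.t)) * (C * ((1 + ‖z.toE4‖ ^ 2) / (2 * z.t))))) := by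
    rw [h1]
    field_simp
    ring
  rw [e, e']
  exact mul_le_mul_of_nonneg_left h3 (by positivity)

/-- The points `(0, s + 1)`, which tend to `∞`. -/
noncomputable def vert (s : ℕ) : HypFour := ⟨0, s + 1, by positivity⟩

theorem norm_vert (s : ℕ) : ‖(vert s).toE4‖ = s + 1 := by
  rw [← sq_eq_sq₀ (norm_nonneg _) (by positivity), norm_sq_toE4]
  simp only [vert, norm_zero]
  ring

theorem norm_le_of_fixes_infty {γ : HypFour ≃ᵢ HypFour}
    (hγ : FixesBoundaryPoint γ OnePoint.infty) (x : HypFour) :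
    1 + ‖(γ x).toE4‖ ^ 2 ≤
      32 * (2 * Real.exp (dist (γ base) base)) ^ 2 * (1 + ‖x.toE4‖ ^ 2) := by
  rw [fixes_infty_iff] at hγ
  have hv : Filter.Tendsto vert Filter.atTop
      (Filter.comap (fun x : HypFour => ‖x.toE4‖) Filter.atTop) := by
    rw [Filter.tendsto_comap_iff]
    have : (fun x : HypFour => ‖x.toE4‖) ∘ vert = fun s : ℕ => (s : ℝ) + 1 :=
      funext norm_vert
    rw [this]
    exact Filter.tendsto_atTop_add_const_right _ _ tendsto_natCast_atTop_atTop
  obtain ⟨s, hs1, hs2⟩ := (((hγ.comp hv).eventually_ge_atTop (1 + ‖(γ x).toE4‖)).and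
    ((tendsto_natCast_atTop_atTop (R := ℝ)).eventually_ge_atTop (1 + 2 * ‖x.toE4‖))).exists
  simp only [Function.comp] at hs1
  have hc := chordal_le γ x (vert s)
  have hn := norm_vert s
  set C := 2 * Real.exp (dist (γ base) base)
  set q := ‖(γ x).toE4‖
  set w := ‖(γ (vert s)).toE4‖
  set p := ‖x.toE4‖
  set z := ‖(vert s).toE4‖
  have hp : 0 ≤ p := norm_nonneg _
  have hq : 0 ≤ q := norm_nonneg _
  have l1 : z / 2 ≤ ‖x.toE4 - (vert s).toE4‖ := by
    have := norm_sub_norm_le (vert s).toE4 x.toE4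
    rw [norm_sub_rev] at this
    have hz : z - p ≤ ‖x.toE4 - (vert s).toE4‖ := this
    linarith
  have l2 : ‖(γ x).toE4 - (γ (vert s)).toE4‖ ≤ 2 * w := by
    have : _ ≤ q + w := norm_sub_le (γ x).toE4 (γ (vert s)).toE4
    linarith
  have z1 : 1 ≤ z := by
    rw [hn]
    have : (0 : ℝ) ≤ s := by positivity
    linarith
  have m1 : (1 + z ^ 2) / 8 ≤ ‖x.toE4 - (vert s).toE4‖ ^ 2 := by
    have := pow_le_pow_left₀ (by positivity) l1 2
    nlinarith
  have m2 : ‖(γ x).toE4 - (γ (vert s)).toE4‖ ^ 2 ≤ 4 * (1 + w ^ 2) := by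
    have := pow_le_pow_left₀ (norm_nonneg _) l2 2
    nlinarith
  have n1 : (1 + z ^ 2) / 8 * ((1 + q ^ 2) * (1 + w ^ 2)) ≤
      C ^ 2 * (4 * (1 + w ^ 2) * ((1 + p ^ 2) * (1 + z ^ 2))) :=
    calc _ ≤ ‖x.toE4 - (vert s).toE4‖ ^ 2 * ((1 + q ^ 2) * (1 + w ^ 2)) := by gcongr
      _ ≤ _ := hc
      _ ≤ _ := by gcongr
  have n2 : (1 + q ^ 2) * ((1 + z ^ 2) * (1 + w ^ 2)) ≤
      (32 * C ^ 2 * (1 + p ^ 2)) * ((1 + z ^ 2) * (1 + w ^ 2)) := by linarith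
  exact le_of_mul_le_mul_right n2
    (show 0 < (1 + z ^ 2) * (1 + w ^ 2) by positivity)

theorem fixes_infty_inv {γ : HypFour ≃ᵢ HypFour} (hγ : FixesBoundaryPoint γ OnePoint.infty) :
    FixesBoundaryPoint γ⁻¹ OnePoint.infty := by
  rw [fixes_infty_iff]
  set K := 32 * (2 * Real.exp (dist (γ base) base)) ^ 2 with hK
  have hKpos : 0 < K := by positivity
  rw [Filter.tendsto_atTop]
  intro b
  refine Filter.mem_comap.2 ⟨Set.Ici (1 + K * (1 + b ^ 2)), Filter.mem_atTop _, fun y hy => ?_⟩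
  by_contra hlt
  have hlt : ‖(γ⁻¹ y).toE4‖ < b := not_le.1 hlt
  have h := norm_le_of_fixes_infty hγ (γ⁻¹ y)
  have e : γ (γ⁻¹ y) = y := γ.apply_symm_apply y
  rw [e, ← hK] at h
  have hy : 1 + K * (1 + b ^ 2) ≤ ‖y.toE4‖ := hy
  have h2 : ‖(γ⁻¹ y).toE4‖ ^ 2 ≤ b ^ 2 := pow_le_pow_left₀ (norm_nonneg _) hlt.le 2
  have h3 : K * (1 + ‖(γ⁻¹ y).toE4‖ ^ 2) ≤ K * (1 + b ^ 2) := by gcongr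
  nlinarith [norm_nonneg y.toE4]

/-- The stabilizer `Γ_∞` of `∞ ∈ ∂ℍ⁴` in a group `Γ` of isometries. -/
def stabInfty (Γ : Subgroup (HypFour ≃ᵢ HypFour)) : Subgroup (HypFour ≃ᵢ HypFour) where
  carrier := {γ | γ ∈ Γ ∧ FixesBoundaryPoint γ OnePoint.infty}
  one_mem' := ⟨Γ.one_mem, Filter.tendsto_comap⟩
  mul_mem' {_ _} ha hb :=
    ⟨Γ.mul_mem ha.1 hb.1, ha.2.comp (Filter.tendsto_comap_iff.2 hb.2)⟩
  inv_mem' {_} ha := ⟨Γ.inv_mem ha.1, fixes_infty_inv ha.2⟩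

end HypFour

namespace HypFour

/-! ### Isometries fixing `∞` -/

/-! An isometry fixing `∞` scales heights and horizontal distances by one common ratio
(`height_mul_height`, `norm_v_sub`), so it acts on `ℝ³` as a similarity. The given screw translation
has ratio one and infinite-order rotation part. Its conjugator to normal form need not fix `∞`, so
both facts are read off displacements `dist (γ x) x`, which conjugation only transports
(`ratio_eq_one_of_conj`, `not_translation_of_conj`). In a discrete group acting freely, it cannot
share the fixed point `∞` with an element of ratio different from one (`not_ratio_lt_one`). Hence
`Γ_∞` acts on `ℝ³` by Euclidean isometries, freely and properly.

The rest is a Bieberbach-type argument, `isCyclic_of_infinite_order`. Some power `α` of the screw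
motion has linear part near, but not equal to, the identity, and an axis `p + ℝ u`. For any `g`, the
iterated commutators `[α, [α, … [α, g]]]` move the origin by amounts tending to zero, so properness
and freeness make one of them trivial. Descending from it, `PreservesLine.of_commutator` shows that
`g` preserves the axis. A free action cannot reverse the axis, so the group acts on it by
translations, faithfully and discretely, and a discrete subgroup of `ℝ` is cyclic. -/

theorem tendsto_norm_sub_div {ι V : Type*} [NormedAddCommGroup V] {l : Filter ι} {y : ι → V}
    (hy : Filter.Tendsto (fun i => ‖y i‖) l Filter.atTop) (a b : V) :
    Filter.Tendsto (fun i => ‖a - y i‖ / ‖b - y i‖) l (nhds 1) := by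
  have hb : Filter.Tendsto (fun i => ‖b - y i‖) l Filter.atTop := by
    refine Filter.tendsto_atTop_mono (fun i => ?_)
      (Filter.tendsto_atTop_add_const_right l (-‖b‖) hy)
    have := norm_sub_norm_le (y i) b
    rw [norm_sub_rev] at this
    linarith
  have h0 : Filter.Tendsto (fun i => ‖a - b‖ / ‖b - y i‖) l (nhds 0) := hb.const_div_atTop _
  rw [tendsto_iff_dist_tendsto_zero]
  refine squeeze_zero' (Filter.Eventually.of_forall fun _ => dist_nonneg) ?_ h0
  filter_upwards [hb.eventually_gt_atTop 0] with i hi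
  rw [Real.dist_eq, div_sub_one hi.ne', abs_div, abs_of_pos hi]
  gcongr
  have := abs_norm_sub_norm_le (a - y i) (b - y i)
  rwa [sub_sub_sub_cancel_right] at this

theorem norm_sq_div_eq (γ : HypFour ≃ᵢ HypFour) (x z : HypFour) :
    ‖x.toE4 - z.toE4‖ ^ 2 / (2 * x.t * z.t) =
      ‖(γ x).toE4 - (γ z).toE4‖ ^ 2 / (2 * (γ x).t * (γ z).t) := by
  have h := cosh_dist (γ x) (γ z)
  rw [γ.dist_eq, cosh_dist] at h
  linarith

theorem tendsto_vert : Filter.Tendsto vert Filter.atTop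
    (Filter.comap (fun x : HypFour => ‖x.toE4‖) Filter.atTop) := by
  rw [Filter.tendsto_comap_iff]
  have : (fun x : HypFour => ‖x.toE4‖) ∘ vert = fun s : ℕ => (s : ℝ) + 1 := funext norm_vert
  rw [this]
  exact Filter.tendsto_atTop_add_const_right _ _ tendsto_natCast_atTop_atTop

/-- Divide the distance identity for the pair `x`, `vert s` by the one for `z`, `vert s`: the height
of `vert s` cancels. As both `vert s` and its image tend to `∞`, the quotients of norms tend to one
and only the height ratios remain. -/
theorem height_mul_height {γ : HypFour ≃ᵢ HypFour} (hγ : FixesBoundaryPoint γ OnePoint.infty)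
    (x z : HypFour) : (γ x).t * z.t = (γ z).t * x.t := by
  rw [fixes_infty_iff] at hγ
  have l1 : Filter.Tendsto (fun s => ‖(vert s).toE4‖) Filter.atTop Filter.atTop :=
    (Filter.tendsto_comap (f := fun x : HypFour => ‖x.toE4‖)).comp tendsto_vert
  have l2 : Filter.Tendsto (fun s => ‖(γ (vert s)).toE4‖) Filter.atTop Filter.atTop :=
    hγ.comp tendsto_vert
  have m1 := ((tendsto_norm_sub_div l1 x.toE4 z.toE4).pow 2).mul_const (z.t / x.t)
  have m2 := ((tendsto_norm_sub_div l2 (γ x).toE4 (γ z).toE4).pow 2).mul_const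
    ((γ z).t / (γ x).t)
  have px := x.t_pos
  have pz := z.t_pos
  have px' := (γ x).t_pos
  have pz' := (γ z).t_pos
  have he : (fun s => (‖x.toE4 - (vert s).toE4‖ / ‖z.toE4 - (vert s).toE4‖) ^ 2 * (z.t / x.t)) =
      fun s => (‖(γ x).toE4 - (γ (vert s)).toE4‖ / ‖(γ z).toE4 - (γ (vert s)).toE4‖) ^ 2 *
        ((γ z).t / (γ x).t) := by
    funext s
    have pv := (vert s).t_pos
    have pv' := (γ (vert s)).t_pos
    have e : ∀ a b p q r : ℝ, 0 < p → 0 < q → 0 < r → (a / b) ^ 2 * (q / p) =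
        (a ^ 2 / (2 * p * r)) / (b ^ 2 / (2 * q * r)) := by
      intro a b p q r hp hq hr
      by_cases hb : b = 0
      · simp [hb]
      · field_simp
    rw [e _ _ _ _ _ px pz pv, e _ _ _ _ _ px' pz' pv', ← norm_sq_div_eq, ← norm_sq_div_eq]
  rw [he] at m1
  have h := tendsto_nhds_unique m1 m2
  rw [one_pow, one_mul, one_mul, div_eq_div_iff px.ne' px'.ne'] at h
  linarith

/-- The ratio of the similarity induced by an isometry fixing `∞`. -/
noncomputable def ratio (γ : HypFour ≃ᵢ HypFour) : ℝ := (γ base).t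

theorem ratio_pos (γ : HypFour ≃ᵢ HypFour) : 0 < ratio γ := (γ base).t_pos

theorem height_apply {γ : HypFour ≃ᵢ HypFour} (hγ : FixesBoundaryPoint γ OnePoint.infty)
    (x : HypFour) : (γ x).t = ratio γ * x.t := by
  have := height_mul_height hγ x base
  rwa [show base.t = 1 from rfl, mul_one] at this

theorem norm_v_sub {γ : HypFour ≃ᵢ HypFour} (hγ : FixesBoundaryPoint γ OnePoint.infty)
    (x z : HypFour) : ‖(γ x).v - (γ z).v‖ = ratio γ * ‖x.v - z.v‖ := by
  have h := norm_sq_div_eq γ x z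
  have px := x.t_pos
  have pz := z.t_pos
  have pr := ratio_pos γ
  rw [norm_sq_sub, norm_sq_sub, height_apply hγ, height_apply hγ,
    div_eq_div_iff (by positivity) (by positivity)] at h
  rw [← sq_eq_sq₀ (norm_nonneg _) (by positivity), mul_pow]
  have hpos : 0 < 2 * x.t * z.t := by positivity
  refine mul_right_cancel₀ hpos.ne' ?_
  nlinarith

/-- The point at height one above `v`. -/
noncomputable def lift (v : EuclideanSpace ℝ (Fin 3)) : HypFour := ⟨v, 1, one_pos⟩

/-- The action on `ℝ³` of an isometry fixing `∞`. -/
noncomputable def trace (γ : HypFour ≃ᵢ HypFour) (v : EuclideanSpace ℝ (Fin 3)) :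
    EuclideanSpace ℝ (Fin 3) := (γ (lift v)).v

/-- Points on one vertical line have horizontal distance zero, and so do their images: the
horizontal coordinate of the image does not depend on the height. -/
theorem v_apply {γ : HypFour ≃ᵢ HypFour} (hγ : FixesBoundaryPoint γ OnePoint.infty)
    (x : HypFour) : (γ x).v = trace γ x.v := by
  have := norm_v_sub hγ x (lift x.v)
  rw [show (lift x.v).v = x.v from rfl, sub_self, norm_zero, mul_zero, norm_eq_zero,
    sub_eq_zero] at this
  exact this

theorem norm_trace_sub {γ : HypFour ≃ᵢ HypFour} (hγ : FixesBoundaryPoint γ OnePoint.infty)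
    (v w : EuclideanSpace ℝ (Fin 3)) : ‖trace γ v - trace γ w‖ = ratio γ * ‖v - w‖ :=
  norm_v_sub hγ (lift v) (lift w)

theorem trace_one (v : EuclideanSpace ℝ (Fin 3)) : trace 1 v = v := rfl

theorem trace_mul {γ : HypFour ≃ᵢ HypFour} (hγ : FixesBoundaryPoint γ OnePoint.infty)
    (δ : HypFour ≃ᵢ HypFour) (v : EuclideanSpace ℝ (Fin 3)) :
    trace (γ * δ) v = trace γ (trace δ v) := v_apply hγ _

theorem ratio_one : ratio 1 = 1 := rfl

theorem ratio_mul {γ : HypFour ≃ᵢ HypFour} (hγ : FixesBoundaryPoint γ OnePoint.infty)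
    (δ : HypFour ≃ᵢ HypFour) : ratio (γ * δ) = ratio γ * ratio δ := height_apply hγ _

/-- This transfers freeness from `ℍ⁴` to the action on `ℝ³`. -/
theorem apply_eq_of_trace_eq {γ : HypFour ≃ᵢ HypFour}
    (hγ : FixesBoundaryPoint γ OnePoint.infty) (hr : ratio γ = 1) {v : EuclideanSpace ℝ (Fin 3)}
    (hv : trace γ v = v) : γ (lift v) = lift v := by
  have h1 := height_apply hγ (lift v)
  rw [hr, one_mul] at h1
  exact HypFour.ext hv h1

/-! ### Discrete groups act properly discontinuously -/

theorem continuous_mk : Continuous fun q : EuclideanSpace ℝ (Fin 3) × Set.Ioi (0 : ℝ) =>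
    (⟨q.1, q.2, q.2.2⟩ : HypFour) := by
  rw [continuous_iff_continuousAt]
  intro q
  rw [ContinuousAt, tendsto_iff_dist_tendsto_zero]
  have h : ∀ r : EuclideanSpace ℝ (Fin 3) × Set.Ioi (0 : ℝ),
      dist (⟨r.1, r.2, r.2.2⟩ : HypFour) ⟨q.1, q.2, q.2.2⟩ =
        Real.arcosh (1 + (‖r.1 - q.1‖ ^ 2 + ((r.2 : ℝ) - q.2) ^ 2) / (2 * (r.2 : ℝ) * q.2)) := by
    intro r
    rw [← norm_sq_sub ⟨r.1, r.2, r.2.2⟩ ⟨q.1, q.2, q.2.2⟩]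
    rfl
  simp only [h]
  have hg : Continuous fun r : EuclideanSpace ℝ (Fin 3) × Set.Ioi (0 : ℝ) =>
      1 + (‖r.1 - q.1‖ ^ 2 + ((r.2 : ℝ) - q.2) ^ 2) / (2 * (r.2 : ℝ) * q.2) := by
    refine continuous_const.add (Continuous.div (by fun_prop) (by fun_prop) fun r => ?_)
    have h1 : (0 : ℝ) < r.2 := r.2.2
    have h2 : (0 : ℝ) < q.2 := q.2.2
    positivity
  have hc : Continuous fun r : EuclideanSpace ℝ (Fin 3) × Set.Ioi (0 : ℝ) =>
      Real.arcosh (1 + (‖r.1 - q.1‖ ^ 2 + ((r.2 : ℝ) - q.2) ^ 2) / (2 * (r.2 : ℝ) * q.2)) := by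
    refine Real.continuousOn_arcosh.comp_continuous hg fun r => ?_
    have h1 : (0 : ℝ) < r.2 := r.2.2
    have h2 : (0 : ℝ) < q.2 := q.2.2
    have : 0 ≤ (‖r.1 - q.1‖ ^ 2 + ((r.2 : ℝ) - q.2) ^ 2) / (2 * (r.2 : ℝ) * q.2) := by positivity
    simpa using this
  have := hc.tendsto q
  simpa using this

/-- A hyperbolic ball lies in the image of a Euclidean compact box. Total boundedness is all that
the later pigeonhole argument needs. -/
theorem totallyBounded_closedBall_base (R : ℝ) :
    TotallyBounded (Metric.closedBall base R) := by
  set C := Real.cosh R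
  have hC : 1 ≤ C := Real.one_le_cosh R
  have hK : IsCompact (Metric.closedBall (0 : EuclideanSpace ℝ (Fin 3)) (2 * C) ×ˢ
      ((↑) ⁻¹' Set.Icc (1 / (2 * C)) (2 * C) : Set (Set.Ioi (0 : ℝ)))) := by
    refine (isCompact_closedBall _ _).prod ?_
    rw [Topology.IsInducing.subtypeVal.isCompact_preimage_iff]
    · exact isCompact_Icc
    · rw [Subtype.range_coe]
      intro x hx
      exact lt_of_lt_of_le (by positivity) hx.1
  refine (hK.image continuous_mk).totallyBounded.subset ?_
  intro x hx
  have hx : dist x base ≤ R := hx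
  have h := Real.cosh_le_cosh.2 (abs_le_abs_of_nonneg dist_nonneg hx)
  have pt := x.t_pos
  -- The ball condition becomes `1 + ‖v‖² + t² ≤ 2 C t`, which gives `1 / (2C) ≤ t ≤ 2C` and, on
  -- completing the square, `‖v‖ ≤ C`.
  rw [cosh_dist_base, norm_sq_toE4, div_le_iff₀ (by positivity)] at h
  have hle : x.t ≤ 2 * C := by
    by_contra! hlt
    nlinarith [sq_nonneg ‖x.v‖]
  refine ⟨(x.v, ⟨x.t, pt⟩), ⟨?_, ?_, hle⟩, rfl⟩
  · rw [mem_closedBall_zero_iff]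
    refine abs_le_of_sq_le_sq' ?_ (by positivity) |>.2
    nlinarith [sq_nonneg (x.t - C), sq_nonneg C]
  · change 1 / (2 * C) ≤ x.t
    rw [div_le_iff₀ (by positivity)]
    nlinarith [sq_nonneg ‖x.v‖, sq_nonneg x.t]

theorem exists_compact_of_discrete {Γ : Subgroup (HypFour ≃ᵢ HypFour)}
    (hdisc : DiscreteTopology Γ) :
    ∃ K : Set HypFour, IsCompact K ∧ ∃ ε > 0, ∀ γ ∈ Γ, (∀ x ∈ K, dist (γ x) x < ε) → γ = 1 := by
  have h1 : ({1} : Set Γ) ∈ nhds (1 : Γ) := (isOpen_discrete _).mem_nhds rfl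
  rw [nhds_subtype_eq_comap, Filter.mem_comap] at h1
  obtain ⟨U, hU, hU1⟩ := h1
  rw [nhds_induced, Filter.mem_comap] at hU
  obtain ⟨W, hW, hWU⟩ := hU
  have hb := nhds_basis_uniformity (ContinuousMap.hasBasis_compactConvergenceUniformity
    (α := HypFour) (β := HypFour)) (x := ⟨_, (1 : HypFour ≃ᵢ HypFour).continuous⟩)
  obtain ⟨⟨K, V⟩, ⟨hK, hV⟩, hKV⟩ := hb.mem_iff.1 hW
  obtain ⟨ε, hε, hεV⟩ := Metric.mem_uniformity_dist.1 hV
  refine ⟨K, hK, ε, hε, fun γ hγ h => ?_⟩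
  have h2 : (⟨γ, hγ⟩ : Γ) ∈ ({1} : Set Γ) := hU1 (hWU (hKV fun x hx => hεV (h x hx)))
  exact congrArg Subtype.val h2

theorem dist_inv_mul_apply (γ δ : HypFour ≃ᵢ HypFour) (x : HypFour) :
    dist ((δ⁻¹ * γ) x) x = dist (γ x) (δ x) := by
  rw [← δ.dist_eq]
  congr 1
  exact δ.apply_symm_apply (γ x)

/-- Pigeonhole on finite nets: record, for each point of an `ε / 4`-net of `K`, a nearby net point
of its image. Two elements with the same record differ by less than `ε` on `K` (four errors of `ε /
4`), hence coincide. -/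
theorem finite_displacement_base_le {Γ : Subgroup (HypFour ≃ᵢ HypFour)}
    (hdisc : DiscreteTopology Γ) (R : ℝ) :
    {γ | γ ∈ Γ ∧ dist (γ base) base ≤ R}.Finite := by
  obtain ⟨K, hK, ε, hε, hKε⟩ := exists_compact_of_discrete hdisc
  obtain ⟨t, ht, hKt⟩ := Metric.totallyBounded_iff.1 hK.totallyBounded (ε / 4) (by positivity)
  obtain ⟨R', hR'⟩ := ht.isBounded.subset_closedBall base
  obtain ⟨N, hN, hNc⟩ := Metric.totallyBounded_iff.1 (totallyBounded_closedBall_base (R' + R))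
    (ε / 4) (by positivity)
  by_contra hinf
  have : Infinite {γ | γ ∈ Γ ∧ dist (γ base) base ≤ R} := Set.infinite_coe_iff.2 hinf
  have : Finite t := ht
  have : Finite N := hN
  have hnear : ∀ γ : {γ | γ ∈ Γ ∧ dist (γ base) base ≤ R}, ∀ y : t, ∃ n : N,
      dist (γ.1 y) n < ε / 4 := by
    intro ⟨γ, _, hγ⟩ y
    have : γ y ∈ Metric.closedBall base (R' + R) := by
      have h1 : dist (y : HypFour) base ≤ R' := hR' y.2
      calc dist (γ y) base ≤ dist (γ y) (γ base) + dist (γ base) base := dist_triangle _ _ _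
        _ ≤ R' + R := by rw [γ.dist_eq]; gcongr
    obtain ⟨n, hn, hd⟩ := Set.mem_iUnion₂.1 (hNc this)
    exact ⟨⟨n, hn⟩, hd⟩
  choose F hF using hnear
  obtain ⟨γ, δ, hne, he⟩ := Finite.exists_ne_map_eq_of_infinite F
  apply hne
  ext1
  have h1 : δ.1⁻¹ * γ.1 = 1 := by
    refine hKε _ (Γ.mul_mem (Γ.inv_mem δ.2.1) γ.2.1) fun x hx => ?_
    obtain ⟨y, hy, hxy⟩ := Set.mem_iUnion₂.1 (hKt hx)
    have hxy : dist x y < ε / 4 := hxy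
    have d1 := hF γ ⟨y, hy⟩
    have d2 := hF δ ⟨y, hy⟩
    rw [← he] at d2
    have t1 := dist_triangle4_right (γ.1 x) (δ.1 x) (γ.1 y) (δ.1 y)
    rw [γ.1.dist_eq, δ.1.dist_eq] at t1
    have t2 := dist_triangle_right (γ.1 y) (δ.1 y) (F γ ⟨y, hy⟩)
    rw [dist_inv_mul_apply]
    linarith
  rw [inv_mul_eq_one] at h1
  exact h1.symm

/-- In a discrete group only finitely many elements move a given point by at most `R`. -/
theorem finite_displacement_le {Γ : Subgroup (HypFour ≃ᵢ HypFour)}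
    (hdisc : DiscreteTopology Γ) (x : HypFour) (R : ℝ) :
    {γ | γ ∈ Γ ∧ dist (γ x) x ≤ R}.Finite := by
  refine (finite_displacement_base_le hdisc (R + 2 * dist x base)).subset ?_
  rintro γ ⟨hγ, h⟩
  refine ⟨hγ, ?_⟩
  have h1 := dist_triangle4 (γ base) (γ x) x base
  rw [γ.dist_eq, dist_comm base] at h1
  have h : dist (γ x) x ≤ R := h
  linarith

/-! ### Euclidean isometries: iterated commutators and axes of screw motions. -/

section Euclidean

variable {V : Type*} [NormedAddCommGroup V] [InnerProductSpace ℝ V]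

/-- A commutator of linear isometries close to the identity is closer to the identity. -/
theorem norm_commutator_sub_le {A B : V ≃ₗᵢ[ℝ] V} {r s : ℝ} (hr : 0 ≤ r) (hs : 0 ≤ s)
    (hA : ∀ v, ‖A v - v‖ ≤ r * ‖v‖) (hB : ∀ v, ‖B v - v‖ ≤ s * ‖v‖) (v : V) :
    ‖(A * B * A⁻¹ * B⁻¹) v - v‖ ≤ 2 * r * s * ‖v‖ := by
  set w := A⁻¹ (B⁻¹ v) with hw
  have hv : v = B (A w) := by
    have h1 : A w = B⁻¹ v := A.apply_symm_apply _
    rw [h1]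
    exact (B.apply_symm_apply v).symm
  have hn : ‖v‖ = ‖w‖ := by rw [hv, B.norm_map, A.norm_map]
  have e : (A * B * A⁻¹ * B⁻¹) v = A (B w) := rfl
  rw [e, hn]
  have h : A (B w) - v = (A (B w - w) - (B w - w)) - (B (A w - w) - (A w - w)) := by
    rw [hv, map_sub, map_sub]; abel
  rw [h]
  calc _ ≤ ‖A (B w - w) - (B w - w)‖ + ‖B (A w - w) - (A w - w)‖ := norm_sub_le _ _
    _ ≤ r * (s * ‖w‖) + s * (r * ‖w‖) :=
        add_le_add ((hA _).trans (by gcongr; exact hB w)) ((hB _).trans (by gcongr; exact hA w))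
    _ = _ := by ring

theorem affineIsometryEquiv_apply_add (α : V ≃ᵃⁱ[ℝ] V) (p w : V) :
    α (p + w) = α p + α.linearIsometryEquiv w := by
  have := α.map_vadd p w
  simpa [add_comm] using this

/-- Taking linear parts. -/
noncomputable def linearPart : (V ≃ᵃⁱ[ℝ] V) →* (V ≃ₗᵢ[ℝ] V) where
  toFun α := α.linearIsometryEquiv
  map_one' := rfl
  map_mul' _ _ := rfl

theorem apply_add_linearPart (α : V ≃ᵃⁱ[ℝ] V) (p w : V) :
    α (p + w) = α p + linearPart α w := affineIsometryEquiv_apply_add α p w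

theorem affine_mul_apply (α β : V ≃ᵃⁱ[ℝ] V) (p : V) : (α * β) p = α (β p) := rfl

theorem affine_apply_inv (α : V ≃ᵃⁱ[ℝ] V) (p : V) : α (α⁻¹ p) = p := α.apply_symm_apply p

/-- The translation part of a commutator. -/
theorem norm_commutator_zero_le {α β : V ≃ᵃⁱ[ℝ] V} {r s q : ℝ}
    (hA : ∀ v, ‖linearPart α v - v‖ ≤ r * ‖v‖) (hB : ∀ v, ‖linearPart β v - v‖ ≤ s * ‖v‖)
    (hC : ∀ v, ‖linearPart (α * β * α⁻¹ * β⁻¹) v - v‖ ≤ q * ‖v‖) :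
    ‖(α * β * α⁻¹ * β⁻¹) 0‖ ≤ s * ‖α 0‖ + (r + q) * ‖β 0‖ := by
  set C := α * β * α⁻¹ * β⁻¹ with hCdef
  -- The relation `C β α = α β` gives `C 0` without computing inverses of affine maps.
  have h1 : C (β (α 0)) = α (β 0) := by
    change (C * β * α) 0 = (α * β) 0
    congr 1
    simp [hCdef]
  have hb : β (α 0) = β 0 + linearPart β (α 0) := by
    simpa using apply_add_linearPart β 0 (α 0)
  have ha : α (β 0) = α 0 + linearPart α (β 0) := by
    simpa using apply_add_linearPart α 0 (β 0)
  have hc : C (β (α 0)) = C 0 + linearPart C (β (α 0)) := by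
    simpa using apply_add_linearPart C 0 (β (α 0))
  set a := α 0
  set b := β 0
  set A := linearPart α
  set B := linearPart β
  set L := linearPart C
  set x := B⁻¹ b
  have hx : B x = b := B.apply_symm_apply b
  have hLBA : L (B a) = A (B (A⁻¹ a)) := by
    have : L * B = A * B * A⁻¹ := by simp [L, hCdef, A, B]
    exact congrArg (fun T : V ≃ₗᵢ[ℝ] V => T a) this
  have key : C 0 = (a - A (B (A⁻¹ a))) + ((A b - b) - (L b - b)) := by
    have : C 0 = α b - L (β a) := by rw [← h1, hc]; abel
    rw [this, ha, hb, map_add, hLBA]; abel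
  have e1 : ‖a - A (B (A⁻¹ a))‖ ≤ s * ‖a‖ := by
    set y := A⁻¹ a
    have hy : A y = a := A.apply_symm_apply a
    have hn : ‖a‖ = ‖y‖ := by rw [← hy, A.norm_map]
    have : a - A (B y) = A (y - B y) := by rw [map_sub, hy]
    rw [this, A.norm_map, norm_sub_rev, hn]
    exact hB y
  rw [key]
  calc _ ≤ ‖a - A (B (A⁻¹ a))‖ + (‖A b - b‖ + ‖L b - b‖) :=
        (norm_add_le _ _).trans (by gcongr; exact norm_sub_le _ _)
    _ ≤ s * ‖a‖ + (r * ‖b‖ + q * ‖b‖) := by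
        gcongr
        · exact hA b
        · exact hC b
    _ = _ := by ring

theorem norm_linearIsometryEquiv_sub_le (A : V ≃ₗᵢ[ℝ] V) (v : V) : ‖A v - v‖ ≤ 2 * ‖v‖ := by
  have := norm_sub_le (A v) v
  rw [A.norm_map] at this
  linarith

/-- The iterated commutators `[α, [α, … [α, g]]]`. -/
def iterCommutator {G : Type*} [Group G] (α g : G) : ℕ → G
  | 0 => g
  | n + 1 => α * iterCommutator α g n * α⁻¹ * (iterCommutator α g n)⁻¹

/-- Each commutator with `α` multiplies the bound by `2 * (1 / 8)`; the initial `2` holds for every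
linear isometry. -/
theorem norm_iterCommutator_sub_le {α g : V ≃ᵃⁱ[ℝ] V}
    (hα : ∀ v, ‖linearPart α v - v‖ ≤ 1 / 8 * ‖v‖) (n : ℕ) :
    ∀ v, ‖linearPart (iterCommutator α g n) v - v‖ ≤ 2 * (1 / 4) ^ n * ‖v‖ := by
  induction n with
  | zero => simpa using norm_linearIsometryEquiv_sub_le _
  | succ n ih =>
    intro v
    have := norm_commutator_sub_le (by norm_num) (by positivity) hα ih v
    simp only [iterCommutator, map_mul, map_inv]
    refine this.trans (le_of_eq ?_)
    ring

/-- The recursion has contraction factor at most `1 / 8 + 1 / 2 = 5 / 8` and forcing term `2 (1 / 4)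
^ n ‖α 0‖`. The constant `16` makes the gap `3 / 4 - 5 / 8` absorb the forcing. -/
theorem norm_iterCommutator_zero_le {α g : V ≃ᵃⁱ[ℝ] V}
    (hα : ∀ v, ‖linearPart α v - v‖ ≤ 1 / 8 * ‖v‖) (n : ℕ) :
    ‖iterCommutator α g n 0‖ ≤ (‖g 0‖ + 16 * ‖α 0‖) * (3 / 4) ^ n := by
  induction n with
  | zero => simp [iterCommutator]
  | succ n ih =>
    have h := norm_commutator_zero_le hα (norm_iterCommutator_sub_le (g := g) hα n)
      (norm_iterCommutator_sub_le (g := g) hα (n + 1))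
    have h1 : (1 / 4 : ℝ) ^ (n + 1) ≤ 1 / 4 := by
      rw [pow_succ]
      have : (1 / 4 : ℝ) ^ n ≤ 1 := pow_le_one₀ (by norm_num) (by norm_num)
      linarith
    have h2 : (1 / 4 : ℝ) ^ n ≤ (3 / 4) ^ n := by gcongr; norm_num
    have hg := norm_nonneg (g 0)
    have ha := norm_nonneg (α 0)
    have hb := norm_nonneg (iterCommutator α g n 0)
    have h3 : (0 : ℝ) ≤ (3 / 4) ^ n := by positivity
    calc _ ≤ _ := h
      _ ≤ 2 * (3 / 4) ^ n * ‖α 0‖ + (1 / 8 + 2 * (1 / 4)) * ‖iterCommutator α g n 0‖ := by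
        gcongr
      _ ≤ 2 * (3 / 4) ^ n * ‖α 0‖ +
          (1 / 8 + 2 * (1 / 4)) * ((‖g 0‖ + 16 * ‖α 0‖) * (3 / 4) ^ n) := by gcongr
      _ ≤ _ := by
        rw [pow_succ]
        nlinarith [mul_nonneg hg h3, mul_nonneg ha h3]

/-- Some positive power of a linear isometry is close to the identity. -/
theorem exists_pow_near_one [FiniteDimensional ℝ V] (B : V ≃ₗᵢ[ℝ] V) {ε : ℝ} (hε : 0 < ε) :
    ∃ k, 0 < k ∧ ∀ v, ‖(B ^ k) v - v‖ ≤ ε * ‖v‖ := by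
  let f : ℕ → (V →L[ℝ] V) := fun n => ((B ^ n).toContinuousLinearEquiv : V →L[ℝ] V)
  have hf : ∀ n, f n ∈ Metric.closedBall (0 : V →L[ℝ] V) 1 := by
    intro n
    rw [mem_closedBall_zero_iff]
    refine ContinuousLinearMap.opNorm_le_bound _ zero_le_one fun v => ?_
    rw [one_mul]
    exact ((B ^ n).norm_map v).le
  -- By compactness two powers of `B` are within `ε`; cancelling the smaller power, an isometry,
  -- leaves a power near the identity.
  obtain ⟨L, φ, hφ, hL⟩ := (tendsto_subseq_of_bounded Metric.isBounded_closedBall hf).imp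
    fun _ h => h.2
  obtain ⟨N, hN⟩ := Metric.cauchySeq_iff.1 hL.cauchySeq ε hε
  have hlt : φ N < φ (N + 1) := hφ (Nat.lt_succ_self N)
  refine ⟨φ (N + 1) - φ N, by omega, fun v => ?_⟩
  have h := hN (N + 1) (by omega) N le_rfl
  rw [dist_eq_norm] at h
  have h2 := (f (φ (N + 1)) - f (φ N)).le_opNorm v
  have h3 : (f (φ (N + 1)) - f (φ N)) v =
      (B ^ φ N) ((B ^ (φ (N + 1) - φ N)) v - v) := by
    have : (B ^ φ N) ((B ^ (φ (N + 1) - φ N)) v) = (B ^ φ N * B ^ (φ (N + 1) - φ N)) v := rfl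
    rw [map_sub, this, ← pow_add, Nat.add_sub_cancel' hlt.le]
    rfl
  rw [h3, (B ^ φ N).norm_map] at h2
  exact h2.trans (by gcongr; exact h.le)

/-- The vectors moved by a linear isometry are orthogonal to the fixed ones. -/
theorem inner_sub_of_fixed {A : V ≃ₗᵢ[ℝ] V} {u : V} (hu : A u = u) (w : V) :
    inner ℝ (A w - w) u = 0 := by
  rw [inner_sub_left]
  nth_rewrite 1 [← hu]
  rw [A.inner_map_map, sub_self]

/-- An affine isometry moves some point by a vector fixed by its linear part. -/
theorem exists_axis_point [FiniteDimensional ℝ V] (α : V ≃ᵃⁱ[ℝ] V) :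
    ∃ p, linearPart α (α p - p) = α p - p := by
  let T : V →ₗ[ℝ] V := ((linearPart α).toLinearEquiv : V →ₗ[ℝ] V) - LinearMap.id
  have hT : ∀ v, T v = linearPart α v - v := fun v => rfl
  have hle : LinearMap.range T ≤ (LinearMap.ker T)ᗮ := by
    rintro _ ⟨w, rfl⟩
    rw [Submodule.mem_orthogonal']
    intro u hu
    rw [LinearMap.mem_ker, hT, sub_eq_zero] at hu
    rw [hT]
    exact inner_sub_of_fixed hu w
  have heq : LinearMap.range T = (LinearMap.ker T)ᗮ := by
    refine Submodule.eq_of_le_of_finrank_eq hle ?_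
    have h1 := T.finrank_range_add_finrank_ker
    have h2 := (LinearMap.ker T).finrank_add_finrank_orthogonal
    omega
  -- Splitting `α 0` into a fixed vector `k` and `A w - w`, the point `-w` is moved by exactly `k`.
  obtain ⟨k, hk, z, hz, h⟩ := (LinearMap.ker T).exists_add_mem_mem_orthogonal (α 0)
  rw [← heq] at hz
  obtain ⟨w, rfl⟩ := hz
  have hp : α (-w) - -w = k := by
    have e := apply_add_linearPart α 0 (-w)
    rw [zero_add] at e
    rw [e, h, hT, map_neg]; abel
  refine ⟨-w, ?_⟩
  rw [hp]
  rwa [LinearMap.mem_ker, hT, sub_eq_zero] at hk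

/-- In dimension three, a linear isometry close to but different from the identity has at most
a line of fixed vectors. -/
theorem mem_span_of_fixed (hV : Module.finrank ℝ V = 3) {A : V ≃ₗᵢ[ℝ] V} (hA1 : A ≠ 1)
    (hA : ∀ v, ‖A v - v‖ ≤ 1 / 8 * ‖v‖) {u w : V} (hu0 : u ≠ 0) (hu : A u = u) (hw : A w = w) :
    ∃ c : ℝ, w = c • u := by
  have : FiniteDimensional ℝ V := Module.finite_of_finrank_eq_succ hV
  by_contra hcon
  push Not at hcon
  have hli : LinearIndependent ℝ ![u, w] := by
    rw [LinearIndependent.pair_iff' hu0]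
    exact fun c hc => hcon c hc.symm
  set W := Submodule.span ℝ (Set.range ![u, w])
  have hW : Module.finrank ℝ W = 2 := by
    simpa using finrank_span_eq_card hli
  have hfix : ∀ y ∈ W, A y = y := by
    have : W ≤ LinearMap.ker ((A.toLinearEquiv : V →ₗ[ℝ] V) - LinearMap.id) := by
      rw [Submodule.span_le]
      rintro _ ⟨i, rfl⟩
      fin_cases i
      · simpa [sub_eq_zero] using hu
      · simpa [sub_eq_zero] using hw
    intro y hy
    simpa [sub_eq_zero] using this hy
  have hort : Module.finrank ℝ Wᗮ = 1 := by
    have := W.finrank_add_finrank_orthogonal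
    omega
  apply hA1
  ext x
  obtain ⟨y, hy, z, hz, rfl⟩ := W.exists_add_mem_mem_orthogonal x
  change A (y + z) = y + z
  rw [map_add, hfix y hy]
  congr 1
  have hAz : A z ∈ Wᗮ := by
    rw [Submodule.mem_orthogonal'] at hz ⊢
    intro t ht
    have := hz t ht
    rw [← hfix t ht, A.inner_map_map, this]
  by_contra hne
  have hz0 : z ≠ 0 := by rintro rfl; exact hne (map_zero A)
  obtain ⟨c, hc⟩ := (finrank_eq_one_iff_of_nonzero' (⟨z, hz⟩ : Wᗮ) (by simpa using hz0)).1 hort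
    ⟨A z, hAz⟩
  have hc : c • z = A z := congrArg Subtype.val hc
  have hzn : 0 < ‖z‖ := norm_pos_iff.2 hz0
  have habs : |c| = 1 := by
    have := A.norm_map z
    rw [← hc, norm_smul, Real.norm_eq_abs] at this
    exact mul_right_cancel₀ hzn.ne' (this.trans (one_mul _).symm)
  -- On the line orthogonal to the fixed plane `A` is `±1`; the sign `-1` would move `z` by `2‖z‖`,
  -- too far.
  rcases eq_or_eq_neg_of_abs_eq habs with rfl | rfl
  · exact hne (by rw [← hc, one_smul])
  · have := hA z
    rw [← hc, neg_one_smul, ← neg_add', norm_neg, ← two_smul ℝ z, norm_smul] at this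
    norm_num at this
    linarith

/-- `g` maps the line `p + ℝ u` to itself. -/
def PreservesLine (p u : V) (g : V ≃ᵃⁱ[ℝ] V) : Prop :=
  (∃ s : ℝ, g p = p + s • u) ∧ ∃ c : ℝ, linearPart g u = c • u

theorem abs_eq_one_of_map_eq_smul {A : V ≃ₗᵢ[ℝ] V} {u : V} (hu : u ≠ 0) {c : ℝ}
    (h : A u = c • u) : c = 1 ∨ c = -1 := by
  have := A.norm_map u
  rw [h, norm_smul, Real.norm_eq_abs] at this
  exact eq_or_eq_neg_of_abs_eq
    (mul_right_cancel₀ (norm_pos_iff.2 hu).ne' (this.trans (one_mul _).symm))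

/-- If the commutator of `h` with a screw motion preserves the axis of the screw motion, then so
does `h`. -/
theorem PreservesLine.of_commutator (hV : Module.finrank ℝ V = 3) {α h : V ≃ᵃⁱ[ℝ] V}
    (hα1 : linearPart α ≠ 1) (hα : ∀ v, ‖linearPart α v - v‖ ≤ 1 / 8 * ‖v‖) {p u : V}
    (hu0 : u ≠ 0) (hp : α p = p + u) (hu : linearPart α u = u)
    (hc : PreservesLine p u (α * h * α⁻¹ * h⁻¹)) : PreservesLine p u h := by
  obtain ⟨⟨s, hs⟩, c, hcu⟩ := hc
  set A := linearPart α with hA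
  set H := linearPart h with hH
  set y := H⁻¹ u with hy
  have hHy : H y = u := H.apply_symm_apply u
  have hAA : ∀ v, A (A⁻¹ v) = v := A.apply_symm_apply
  have hcu' : A (H (A⁻¹ y)) = c • u := by
    rw [map_mul, map_mul, map_mul, map_inv, map_inv] at hcu
    exact hcu
  have hy0 : y ≠ 0 := by
    rintro h0
    rw [h0, map_zero] at hHy
    exact hu0 hHy.symm
  -- Since `A` fixes `u`, the equation for the commutator says that `A⁻¹` maps the line of `y = H⁻¹
  -- u` to itself. The sign `-1` is excluded by closeness to the identity, so `y` is fixed by `A`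
  -- and parallel to `u`.
  have h1 : A⁻¹ y = c • y := by
    apply H.injective
    apply A.injective
    rw [hcu', map_smul, map_smul, hHy, hu]
  have hAy : A y = y := by
    have h2 : y = c • A y := by rw [← map_smul, ← h1, hAA]
    rcases abs_eq_one_of_map_eq_smul hy0 h1 with rfl | rfl
    · rw [one_smul] at h2; exact h2.symm
    · exfalso
      have h3 : A y = -y := by
        nth_rewrite 2 [h2]; simp
      have := hα y
      rw [h3, ← neg_add', norm_neg, ← two_smul ℝ y, norm_smul] at this
      have := norm_pos_iff.2 hy0
      rw [Real.norm_ofNat] at *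
      linarith
  obtain ⟨d, hd⟩ := mem_span_of_fixed hV hα1 hα hu0 hu hAy
  have hd0 : d ≠ 0 := by
    rintro rfl
    rw [zero_smul] at hd
    exact hy0 hd
  have hHu : H u = d⁻¹ • u := by
    rw [hd, map_smul] at hHy
    nth_rewrite 2 [← hHy]
    rw [smul_smul, inv_mul_cancel₀ hd0, one_smul]
  refine ⟨?_, d⁻¹, hHu⟩
  set q := h⁻¹ p with hq
  have hhq : h q = p := affine_apply_inv h p
  have hs' : α (h (α⁻¹ q)) = p + s • u := hs
  have h4 : h (α⁻¹ q) = p + (s - 1) • u := by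
    apply α.injective
    rw [hs', apply_add_linearPart, ← hA, map_smul, hu, hp, sub_smul, one_smul]
    abel
  have h5 : α⁻¹ q = q + ((s - 1) * d) • u := by
    apply h.injective
    rw [h4, apply_add_linearPart, hhq, ← hH, map_smul, hHu, smul_smul, mul_assoc,
      mul_inv_cancel₀ hd0, mul_one]
  -- So `α` moves `q = h⁻¹ p` along `u`. For `w = q - p`, the vector `A w - w` is then both parallel
  -- and orthogonal to `u`, hence zero, and `q` lies on the axis.
  have h6 : q = α q + ((s - 1) * d) • u := by
    have : q = α (α⁻¹ q) := (affine_apply_inv α q).symm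
    rw [h5, apply_add_linearPart, ← hA, map_smul, hu] at this
    exact this
  obtain ⟨w, hw⟩ : ∃ w, q = p + w := ⟨q - p, by abel⟩
  rw [hw, apply_add_linearPart, ← hA, hp] at h6
  have h7 : A w - w = (-(1 + (s - 1) * d)) • u := by
    rw [neg_smul, add_smul, one_smul]
    have h6 := congrArg (fun z => z - p - w) h6
    simp only [add_sub_cancel_left, sub_self] at h6
    rw [eq_neg_iff_add_eq_zero, h6]
    abel
  have h8 : A w = w := by
    rw [← sub_eq_zero, ← inner_self_eq_zero (𝕜 := ℝ)]
    nth_rewrite 2 [h7]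
    rw [inner_smul_right, inner_sub_of_fixed hu, mul_zero]
  obtain ⟨x, hx⟩ := mem_span_of_fixed hV hα1 hα hu0 hu h8
  refine ⟨-(x * d⁻¹), ?_⟩
  rw [hw, hx, apply_add_linearPart, ← hH, map_smul, hHu, smul_smul] at hhq
  rw [neg_smul]
  exact eq_add_neg_of_add_eq hhq

/-- A group acting freely and properly on Euclidean three-space by isometries, containing an
element whose linear part has infinite order, is infinite cyclic. -/
theorem isCyclic_of_infinite_order (hV : Module.finrank ℝ V = 3) {G : Type*} [Group G]
    (Φ : G →* (V ≃ᵃⁱ[ℝ] V)) (hfree : ∀ g v, Φ g v = v → g = 1)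
    (hprop : ∀ R : ℝ, {g | ‖Φ g 0‖ ≤ R}.Finite) {γ : G}
    (hγ : ∀ n, 0 < n → linearPart (Φ γ) ^ n ≠ 1) : IsCyclic G := by
  have : FiniteDimensional ℝ V := Module.finite_of_finrank_eq_succ hV
  obtain ⟨k, hk, hsmall⟩ := exists_pow_near_one (linearPart (Φ γ)) (show (0 : ℝ) < 1 / 8 by norm_num)
  set α := γ ^ k with hα
  have hαpow : linearPart (Φ α) = linearPart (Φ γ) ^ k := by rw [hα, map_pow, map_pow]
  have hα1 : linearPart (Φ α) ≠ 1 := hαpow ▸ hγ k hk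
  have hs : ∀ v, ‖linearPart (Φ α) v - v‖ ≤ 1 / 8 * ‖v‖ := hαpow ▸ hsmall
  obtain ⟨p, hp⟩ := exists_axis_point (Φ α)
  obtain ⟨u, hu⟩ : ∃ u, u = Φ α p - p := ⟨_, rfl⟩
  rw [← hu] at hp
  have hαp : Φ α p = p + u := by rw [hu]; abel
  have hu0 : u ≠ 0 := by
    rintro rfl
    rw [add_zero] at hαp
    have := hfree α p hαp
    rw [this, map_one, map_one] at hα1
    exact hα1 rfl
  have hiter : ∀ g n, Φ (iterCommutator α g n) = iterCommutator (Φ α) (Φ g) n := by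
    intro g n
    induction n with
    | zero => rfl
    | succ n ih => simp only [iterCommutator, map_mul, map_inv, ih]
  have hline : ∀ g, PreservesLine p u (Φ g) := by
    intro g
    -- Otherwise the commutators, finitely many elements by properness, would have a smallest
    -- displacement of the origin. It is positive by freeness, yet the displacements tend to zero.
    obtain ⟨n, hn⟩ : ∃ n, iterCommutator α g n = 1 := by
      by_contra! hcon
      set K := ‖Φ g 0‖ + 16 * ‖Φ α 0‖
      have hb : ∀ n, ‖Φ (iterCommutator α g n) 0‖ ≤ K * (3 / 4) ^ n := fun n => by
        rw [hiter]; exact norm_iterCommutator_zero_le hs n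
      have hK : 0 ≤ K := by positivity
      have hfin := hprop K
      have hmem : ∀ n, iterCommutator α g n ∈ {g | ‖Φ g 0‖ ≤ K} := fun n =>
        (hb n).trans (mul_le_of_le_one_right hK (pow_le_one₀ (by norm_num) (by norm_num)))
      obtain ⟨n₀, hn₀⟩ := (hfin.subset (Set.range_subset_iff.2 hmem)).exists_minimalFor
        (fun g => ‖Φ g 0‖) _ (Set.range_nonempty _)
      obtain ⟨⟨m, rfl⟩, hmin⟩ := hn₀
      have hpos : 0 < ‖Φ (iterCommutator α g m) 0‖ :=
        norm_pos_iff.2 fun h => hcon m (hfree _ 0 h)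
      have hlim : Filter.Tendsto (fun n : ℕ => K * (3 / 4 : ℝ) ^ n) Filter.atTop (nhds 0) := by
        simpa using (tendsto_pow_atTop_nhds_zero_of_lt_one (r := (3 / 4 : ℝ)) (by norm_num)
          (by norm_num)).const_mul K
      obtain ⟨n, hn⟩ := (hlim.eventually_lt_const hpos).exists
      have h1 := (hb n).trans_lt hn
      exact absurd (hmin (Set.mem_range_self n) h1.le) (not_le.2 h1)
    have hbase : PreservesLine p u (Φ (iterCommutator α g n)) := by
      rw [hn, map_one]
      exact ⟨⟨0, by simp⟩, 1, by simp⟩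
    clear hn
    induction n with
    | zero => exact hbase
    | succ n ih =>
      refine ih (PreservesLine.of_commutator hV hα1 hs hu0 hαp hp ?_)
      simpa only [iterCommutator, map_mul, map_inv] using hbase
  have hlin : ∀ g, linearPart (Φ g) u = u := by
    intro g
    obtain ⟨⟨s, hs⟩, c, hc⟩ := hline g
    rcases abs_eq_one_of_map_eq_smul hu0 hc with rfl | rfl
    · rw [hc, one_smul]
    -- An element reversing the axis fixes the midpoint of `p` and its image.
    · have : g = 1 := by
        apply hfree g (p + (s / 2) • u)
        rw [apply_add_linearPart, map_smul, hc, hs, add_assoc, smul_smul, ← add_smul]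
        congr 2
        ring
      rw [this, map_one, map_one]
      rfl
  choose s hs using fun g => (hline g).1
  have hsmul : ∀ a b : ℝ, p + a • u = p + b • u → a = b := fun a b h =>
    smul_left_injective ℝ hu0 (add_left_cancel h)
  let S : G →* Multiplicative ℝ :=
    { toFun := fun g => Multiplicative.ofAdd (s g)
      map_one' := by
        apply congrArg Multiplicative.ofAdd
        apply hsmul
        rw [← hs, map_one]
        simp
      map_mul' := fun g h => by
        rw [← ofAdd_add]
        apply congrArg Multiplicative.ofAdd
        apply hsmul
        rw [← hs, map_mul, affine_mul_apply, hs, apply_add_linearPart, map_smul, hlin, hs,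
          add_smul, add_assoc] }
  have hinj : Function.Injective S := by
    rw [injective_iff_map_eq_one]
    intro g hg
    have h0 : s g = 0 := hg
    apply hfree g p
    rw [hs, h0, zero_smul, add_zero]
  have hunorm : 0 < ‖u‖ := norm_pos_iff.2 hu0
  have hfinS : {g | |s g| ≤ 1}.Finite := by
    refine (hprop (‖u‖ + 2 * ‖p‖)).subset fun g hg => ?_
    have e : Φ g 0 = s g • u + (p - linearPart (Φ g) p) := by
      have := apply_add_linearPart (Φ g) 0 p
      rw [zero_add, hs] at this
      rw [← sub_eq_iff_eq_add] at this
      rw [← this]; abel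
    have hg : |s g| ≤ 1 := hg
    calc ‖Φ g 0‖ ≤ ‖s g • u‖ + (‖p‖ + ‖linearPart (Φ g) p‖) := by
          rw [e]; exact (norm_add_le _ _).trans (by gcongr; exact norm_sub_le _ _)
      _ = |s g| * ‖u‖ + 2 * ‖p‖ := by
          rw [norm_smul, Real.norm_eq_abs, LinearIsometryEquiv.norm_map]; ring
      _ ≤ 1 * ‖u‖ + 2 * ‖p‖ := by gcongr
      _ = _ := by ring
  let H : AddSubgroup ℝ := (MonoidHom.toAdditive S).range
  have hmemH : ∀ x, x ∈ H ↔ ∃ g, s g = x := fun x => Iff.rfl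
  obtain ⟨ε, hε, hdisj⟩ : ∃ ε : ℝ, 0 < ε ∧ Disjoint (H : Set ℝ) (Set.Ioo 0 ε) := by
    -- Adjoining `1` makes the set nonempty and keeps its minimum at most `1`, inside the range
    -- covered by `hfinS`.
    have hfin2 : ((s '' {g | |s g| ≤ 1}) ∩ Set.Ioi 0 ∪ {1}).Finite :=
      ((hfinS.image s).inter_of_left _).union (Set.finite_singleton _)
    obtain ⟨ε, hε, hmin⟩ := hfin2.exists_minimal ⟨1, Or.inr rfl⟩
    have hpos : 0 < ε := by
      rcases hε with h | h
      · exact h.2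
      · rw [h]; exact one_pos
    have hle1 : ε ≤ 1 := by
      by_contra! h
      exact absurd (hmin (Or.inr rfl) h.le) (not_le.2 h)
    refine ⟨ε, hpos, Set.disjoint_left.2 fun x hx hx2 => ?_⟩
    obtain ⟨g, rfl⟩ := (hmemH x).1 hx
    have hx1 : |s g| ≤ 1 := by
      rw [abs_of_pos hx2.1]; exact hx2.2.le.trans hle1
    exact absurd (hmin (Or.inl ⟨⟨g, hx1, rfl⟩, hx2.1⟩) hx2.2.le) (not_le.2 hx2.2)
  obtain ⟨b, hb⟩ := AddSubgroup.cyclic_of_isolated_zero hε hdisj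
  have hcyc : ∃ g₀, ∀ g, ∃ n : ℤ, s g = n * s g₀ := by
    have hbH : b ∈ H := by rw [hb]; exact AddSubgroup.mem_closure_singleton_self b
    obtain ⟨g₀, hg₀⟩ := (hmemH b).1 hbH
    refine ⟨g₀, fun g => ?_⟩
    have : s g ∈ H := (hmemH _).2 ⟨g, rfl⟩
    rw [hb, AddSubgroup.mem_closure_singleton] at this
    obtain ⟨n, hn⟩ := this
    exact ⟨n, by rw [hg₀, ← hn, zsmul_eq_mul]⟩
  obtain ⟨g₀, hg₀⟩ := hcyc
  refine ⟨g₀, fun g => ?_⟩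
  obtain ⟨n, hn⟩ := hg₀ g
  refine ⟨n, hinj ?_⟩
  change S (g₀ ^ n) = S g
  rw [map_zpow]
  change Multiplicative.ofAdd (s g₀) ^ n = Multiplicative.ofAdd (s g)
  rw [← ofAdd_zsmul, zsmul_eq_mul, hn]

end Euclidean

/-! ### Screw translations fixing `∞` -/

theorem toEuclideanLin_mul_apply (A B : Matrix (Fin 3) (Fin 3) ℝ)
    (v : EuclideanSpace ℝ (Fin 3)) :
    Matrix.toEuclideanLin (A * B) v = Matrix.toEuclideanLin A (Matrix.toEuclideanLin B v) := by
  simp [Matrix.toLpLin_apply, Matrix.mulVec_mulVec]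

theorem norm_toEuclideanLin_apply {A : Matrix (Fin 3) (Fin 3) ℝ}
    (hA : A ∈ Matrix.specialOrthogonalGroup (Fin 3) ℝ) (v : EuclideanSpace ℝ (Fin 3)) :
    ‖Matrix.toEuclideanLin A v‖ = ‖v‖ := by
  have h : A.transpose * A = 1 :=
    (Matrix.mem_orthogonalGroup_iff' (Fin 3) ℝ).1 (Matrix.mem_specialOrthogonalGroup_iff.1 hA).1
  rw [← sq_eq_sq₀ (norm_nonneg _) (norm_nonneg _), EuclideanSpace.real_norm_sq_eq,
    EuclideanSpace.real_norm_sq_eq]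
  have e : ∀ w : EuclideanSpace ℝ (Fin 3), ∑ i, w i ^ 2 = w.ofLp ⬝ᵥ w.ofLp := fun w =>
    Finset.sum_congr rfl fun i _ => sq _
  rw [e, e, Matrix.toLpLin_apply]
  change (A.mulVec v.ofLp) ⬝ᵥ (A.mulVec v.ofLp) = _
  rw [Matrix.dotProduct_mulVec, Matrix.vecMul_mulVec, h, Matrix.vecMul_one]

theorem normalForm_comp (A B : Matrix (Fin 3) (Fin 3) ℝ) (a b : EuclideanSpace ℝ (Fin 3))
    (x : HypFour) : normalForm A a (normalForm B b x) =
      normalForm (A * B) (Matrix.toEuclideanLin A b + a) x := by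
  apply HypFour.ext
  · simp only [normalForm, map_add, toEuclideanLin_mul_apply, add_assoc]
  · rfl

theorem exists_pow_eq_normalForm {N : HypFour ≃ᵢ HypFour} {A : Matrix (Fin 3) (Fin 3) ℝ}
    {a : EuclideanSpace ℝ (Fin 3)} (hN : ∀ x, N x = normalForm A a x) (n : ℕ) :
    ∃ b, ∀ x, (N ^ n) x = normalForm (A ^ n) b x := by
  induction n with
  | zero =>
    refine ⟨0, fun x => ?_⟩
    apply HypFour.ext
    · simp [normalForm, Matrix.toLpLin_one]
    · rfl
  | succ n ih =>
    obtain ⟨b, hb⟩ := ih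
    refine ⟨Matrix.toEuclideanLin (A ^ n) a + b, fun x => ?_⟩
    rw [pow_succ, pow_succ]
    change (N ^ n) (N x) = _
    rw [hb, hN, normalForm_comp]

theorem cosh_dist_of_height_eq {x y : HypFour} (h : y.t = x.t) :
    Real.cosh (dist y x) = 1 + ‖y.v - x.v‖ ^ 2 / (2 * x.t ^ 2) := by
  rw [cosh_dist, norm_sq_sub, h]
  ring_nf

/-- At constant height `cosh ρ - 1` is proportional to the squared Euclidean displacement, so a
factor of four becomes a factor of two. -/
theorem norm_iterate_sub_of_cosh {N : HypFour ≃ᵢ HypFour} {A : Matrix (Fin 3) (Fin 3) ℝ}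
    {a : EuclideanSpace ℝ (Fin 3)} (hN : ∀ x, N x = normalForm A a x)
    (h : ∀ x, Real.cosh (dist (N (N x)) x) - 1 = 4 * (Real.cosh (dist (N x) x) - 1))
    (v : EuclideanSpace ℝ (Fin 3)) :
    ‖Matrix.toEuclideanLin A (Matrix.toEuclideanLin A v + a) + a - v‖ =
      2 * ‖Matrix.toEuclideanLin A v + a - v‖ := by
  have h1 := h (lift v)
  rw [cosh_dist_of_height_eq (by simp only [hN]; rfl),
    cosh_dist_of_height_eq (by simp only [hN]; rfl)] at h1
  simp only [hN] at h1
  rw [← sq_eq_sq₀ (norm_nonneg _) (by positivity)]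
  simp only [normalForm, lift] at h1
  linarith

/-- An orthogonal normal form whose square displaces all points twice as far is a translation. -/
theorem eq_one_of_norm_iterate_sub {A : Matrix (Fin 3) (Fin 3) ℝ}
    (hA : A ∈ Matrix.specialOrthogonalGroup (Fin 3) ℝ) {a : EuclideanSpace ℝ (Fin 3)}
    (h : ∀ v, ‖Matrix.toEuclideanLin A (Matrix.toEuclideanLin A v + a) + a - v‖ =
      2 * ‖Matrix.toEuclideanLin A v + a - v‖) : A = 1 := by
  set T := Matrix.toEuclideanLin A with hT
  have hnorm : ∀ v, ‖T v‖ = ‖v‖ := norm_toEuclideanLin_apply hA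
  have h1 : ∀ v, T (T v + a - v) = T v + a - v := by
    intro v
    have e : T (T v + a) + a - v = T (T v + a - v) + (T v + a - v) := by
      simp only [map_add, map_sub]; abel
    have h2 := h v
    rw [e] at h2
    have h3 := hnorm (T v + a - v)
    set d := T v + a - v
    -- Equality in `‖T d + d‖ ≤ ‖T d‖ + ‖d‖` with `‖T d‖ = ‖d‖` forces `T d = d`.
    have h4 := parallelogram_law_with_norm ℝ (T d) d
    rw [h2, h3] at h4
    have h5 : ‖T d - d‖ = 0 := by nlinarith [norm_nonneg (T d - d)]
    rwa [norm_eq_zero, sub_eq_zero] at h5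
  have ha : T a = a := by simpa using h1 0
  have h2 : ∀ v, T v = v := by
    intro v
    have h3 : T (T v - v) = T v - v := by
      have := h1 v
      rw [add_sub_right_comm, map_add, ha] at this
      exact add_right_cancel this
    set d := T v - v with hd
    have e2 : T (T v) = v + (2 : ℝ) • d := by
      have : T v = v + d := by rw [hd]; abel
      rw [this, map_add, h3, this, two_smul]; abel
    have h4 := hnorm v
    have h5 := hnorm (T v)
    rw [e2] at h5
    have hTv : T v = v + d := by rw [hd]; abel
    rw [hTv] at h4 h5
    have p := parallelogram_law_with_norm ℝ (v + d) d
    -- The collinear points `v`, `v + d`, `v + 2d` have equal norm, so `d = 0`.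
    rw [add_assoc, ← two_smul ℝ d, add_sub_cancel_right, h5, h4] at p
    have h6 : ‖d‖ = 0 := by nlinarith [norm_nonneg d]
    rwa [norm_eq_zero, hd, sub_eq_zero] at h6
  apply Matrix.toEuclideanLin.injective
  ext1 v
  rw [← hT, h2]
  simp [Matrix.toLpLin_one]

/-- The ratio of an irrational screw translation fixing `∞` is one. -/
theorem ratio_eq_one_of_conj {γ h : HypFour ≃ᵢ HypFour}
    (hγ : FixesBoundaryPoint γ OnePoint.infty) {A : Matrix (Fin 3) (Fin 3) ℝ}
    {a : EuclideanSpace ℝ (Fin 3)} (hN : ∀ x, (h * γ * h⁻¹) x = normalForm A a x) :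
    ratio γ = 1 := by
  have hr := ratio_pos γ
  have h1 : ∀ x, (ratio γ - 1) ^ 2 / (2 * ratio γ) ≤ Real.cosh (dist (γ x) x) - 1 := by
    intro x
    have px := x.t_pos
    rw [cosh_dist, norm_sq_sub, height_apply hγ, add_sub_cancel_left,
      div_le_div_iff₀ (by positivity) (by positivity)]
    have : 0 ≤ ‖(γ x).v - x.v‖ ^ 2 * (2 * ratio γ) := by positivity
    nlinarith
  -- High up, the normal form displaces `vert s` by arbitrarily little, whereas `h1` bounds all
  -- displacements of `γ` below, strictly above zero if the ratio is not one.
  have h2 : ∀ s : ℕ, (ratio γ - 1) ^ 2 / (2 * ratio γ) ≤ ‖a‖ ^ 2 / 2 / ((s : ℝ) + 1) ^ 2 := by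
    intro s
    refine (h1 (h⁻¹ (vert s))).trans (le_of_eq ?_)
    have e : dist (γ (h⁻¹ (vert s))) (h⁻¹ (vert s)) = dist ((h * γ * h⁻¹) (vert s)) (vert s) := by
      rw [← h.dist_eq]
      congr 1
      exact h.apply_symm_apply _
    rw [e, hN, cosh_dist_of_height_eq (x := vert s) (y := normalForm A a (vert s)) rfl]
    simp only [normalForm, vert, map_zero, zero_add, sub_zero]
    rw [add_sub_cancel_left, div_div]
  have hlim : Filter.Tendsto (fun s : ℕ => ‖a‖ ^ 2 / 2 / ((s : ℝ) + 1) ^ 2) Filter.atTop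
      (nhds 0) :=
    Filter.Tendsto.const_div_atTop ((Filter.tendsto_pow_atTop two_ne_zero).comp
      (Filter.tendsto_atTop_add_const_right _ _ tendsto_natCast_atTop_atTop)) _
  have h3 := ge_of_tendsto' hlim h2
  rw [div_le_iff₀ (by positivity), zero_mul] at h3
  have : ratio γ - 1 = 0 := by
    rw [← sq_eq_zero_iff]; exact le_antisymm h3 (sq_nonneg _)
  linarith

/-- A conjugate of an irrational screw translation is not a Euclidean translation. -/
theorem not_translation_of_conj {γ h : HypFour ≃ᵢ HypFour}
    {A : Matrix.specialOrthogonalGroup (Fin 3) ℝ} {a : EuclideanSpace ℝ (Fin 3)}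
    (hA : ¬ IsOfFinOrder A)
    (hN : ∀ x, (h * γ * h⁻¹) x = normalForm (A : Matrix (Fin 3) (Fin 3) ℝ) a x) {n : ℕ}
    (hn : 0 < n) {c : EuclideanSpace ℝ (Fin 3)}
    (hc : ∀ x, ((γ ^ n) x).v = x.v + c ∧ ((γ ^ n) x).t = x.t) : False := by
  obtain ⟨b, hb⟩ := exists_pow_eq_normalForm hN n
  -- For a translation, `cosh ρ - 1` quadruples under squaring. This property survives conjugation
  -- by any isometry, so it passes to the normal form.
  have hcosh : ∀ x, Real.cosh (dist ((γ ^ n) ((γ ^ n) x)) x) - 1 =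
      4 * (Real.cosh (dist ((γ ^ n) x) x) - 1) := by
    intro x
    have e1 : x.v + c - x.v = c := add_sub_cancel_left _ _
    have e2 : x.v + c + c - x.v = (2 : ℝ) • c := by rw [two_smul]; abel
    rw [cosh_dist_of_height_eq ((hc _).2.trans (hc _).2), cosh_dist_of_height_eq (hc _).2,
      (hc _).1, (hc _).1, e1, e2, norm_smul, Real.norm_ofNat]
    ring
  have hpow : ∀ x, ((h * γ * h⁻¹) ^ n) x = h ((γ ^ n) (h⁻¹ x)) := by
    intro x; rw [conj_pow]; rfl
  refine hA (isOfFinOrder_iff_pow_eq_one.2 ⟨n, hn, ?_⟩)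
  ext1
  refine eq_one_of_norm_iterate_sub (A ^ n).2 (a := b)
    (norm_iterate_sub_of_cosh (N := (h * γ * h⁻¹) ^ n) hb fun x => ?_)
  have e := hcosh (h⁻¹ x)
  have hx : h (h⁻¹ x) = x := h.apply_symm_apply x
  have hx' : ∀ y, h⁻¹ (h y) = y := h.symm_apply_apply
  rw [hpow, hpow, hx']
  nth_rewrite 2 4 [← hx]
  rw [h.dist_eq, h.dist_eq]
  exact e

/-! ### The stabilizer acts on `ℝ³` by isometries -/

theorem ratio_pow {γ : HypFour ≃ᵢ HypFour} (Γ : Subgroup (HypFour ≃ᵢ HypFour))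
    (hγ : γ ∈ stabInfty Γ) (n : ℕ) : ratio (γ ^ n) = ratio γ ^ n := by
  induction n with
  | zero => rfl
  | succ n ih => rw [pow_succ, ratio_mul ((stabInfty Γ).pow_mem hγ n).2, ih, pow_succ]

/-- If `g` contracts `ℝ³` towards `p`, the conjugates `g ^ k * γ * (g ^ k)⁻¹` move `p` by `ratio g ^
k * ‖γ p - p‖`. By freeness these numbers are nonzero, so the conjugates are infinitely many
elements moving `lift p` a bounded distance, against discreteness. -/
theorem not_ratio_lt_one {Γ : Subgroup (HypFour ≃ᵢ HypFour)} (hdisc : DiscreteTopology Γ)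
    (hfree : ∀ γ ∈ Γ, γ ≠ 1 → ∀ x : HypFour, γ x ≠ x) {γ : HypFour ≃ᵢ HypFour}
    (hγ : γ ∈ stabInfty Γ) (hγ1 : γ ≠ 1) (hr : ratio γ = 1) {g : HypFour ≃ᵢ HypFour}
    (hg : g ∈ stabInfty Γ) : ¬ ratio g < 1 := by
  intro hlt
  have hgp := ratio_pos g
  have hcontr : ContractingWith ⟨ratio g, hgp.le⟩ (trace g) := by
    refine ⟨hlt, LipschitzWith.of_dist_le_mul fun v w => ?_⟩
    rw [dist_eq_norm, dist_eq_norm, norm_trace_sub hg.2]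
    rfl
  set p := hcontr.fixedPoint
  have hp : trace g p = p := hcontr.fixedPoint_isFixedPt
  have hpk : ∀ k : ℕ, trace (g ^ k) p = p := by
    intro k
    induction k with
    | zero => rfl
    | succ k ih => rw [pow_succ, trace_mul ((stabInfty Γ).pow_mem hg k).2, hp, ih]
  have hpinv : ∀ k : ℕ, trace (g ^ k)⁻¹ p = p := by
    intro k
    have hk := (stabInfty Γ).pow_mem hg k
    nth_rewrite 1 [← hpk k]
    rw [← trace_mul ((stabInfty Γ).inv_mem hk).2, inv_mul_cancel, trace_one]
  set δ : ℕ → (HypFour ≃ᵢ HypFour) := fun k => g ^ k * γ * (g ^ k)⁻¹ with hδ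
  have hδmem : ∀ k, δ k ∈ stabInfty Γ := fun k =>
    (stabInfty Γ).mul_mem ((stabInfty Γ).mul_mem ((stabInfty Γ).pow_mem hg k) hγ)
      ((stabInfty Γ).inv_mem ((stabInfty Γ).pow_mem hg k))
  set q := trace γ p
  have hqp : 0 < ‖q - p‖ := by
    rw [norm_pos_iff, sub_ne_zero]
    exact fun h => hfree γ hγ.1 hγ1 _ (apply_eq_of_trace_eq hγ.2 hr h)
  have hdisp : ∀ k, ‖trace (δ k) p - p‖ = ratio g ^ k * ‖q - p‖ := by
    intro k
    have hk := (stabInfty Γ).pow_mem hg k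
    have : trace (δ k) p = trace (g ^ k) q := by
      rw [hδ]
      simp only
      rw [trace_mul ((stabInfty Γ).mul_mem hk hγ).2, hpinv, trace_mul hk.2]
    rw [this]
    nth_rewrite 1 [← hpk k]
    rw [norm_trace_sub hk.2, ratio_pow Γ hg]
  have hratio : ∀ k, ratio (δ k) = 1 := by
    intro k
    have hk := (stabInfty Γ).pow_mem hg k
    have h1 : ratio (g ^ k) * ratio (g ^ k)⁻¹ = 1 := by
      rw [← ratio_mul hk.2, mul_inv_cancel, ratio_one]
    rw [hδ]
    simp only
    rw [ratio_mul ((stabInfty Γ).mul_mem hk hγ).2, ratio_mul hk.2, hr, mul_one, h1]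
  have hinj : Function.Injective δ := by
    intro k l hkl
    have h1 := hdisp k
    rw [hkl, hdisp l] at h1
    exact (pow_right_injective₀ hgp hlt.ne (mul_right_cancel₀ hqp.ne' h1)).symm
  refine Set.infinite_range_of_injective hinj
    ((finite_displacement_le hdisc (lift p) (Real.arcosh (1 + ‖q - p‖ ^ 2))).subset ?_)
  rintro _ ⟨k, rfl⟩
  refine ⟨(hδmem k).1, ?_⟩
  have hle : (1 : ℝ) ≤ 1 + ‖q - p‖ ^ 2 := by nlinarith
  rw [← abs_of_nonneg (dist_nonneg (x := δ k (lift p))), ← abs_of_nonneg (Real.arcosh_nonneg hle),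
    ← Real.cosh_le_cosh, Real.cosh_arcosh hle, cosh_dist_of_height_eq
      (by rw [height_apply (hδmem k).2, hratio, one_mul])]
  have h1 : ‖(δ k (lift p)).v - (lift p).v‖ ≤ ‖q - p‖ := by
    refine (hdisp k).le.trans (mul_le_of_le_one_left hqp.le (pow_le_one₀ hgp.le hlt.le))
  have h2 : ‖(δ k (lift p)).v - (lift p).v‖ ^ 2 ≤ ‖q - p‖ ^ 2 := by gcongr
  have h3 : (lift p).t = 1 := rfl
  rw [h3]
  nlinarith [sq_nonneg ‖q - p‖]

theorem ratio_eq_one {Γ : Subgroup (HypFour ≃ᵢ HypFour)} (hdisc : DiscreteTopology Γ)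
    (hfree : ∀ γ ∈ Γ, γ ≠ 1 → ∀ x : HypFour, γ x ≠ x) {γ : HypFour ≃ᵢ HypFour}
    (hγ : γ ∈ stabInfty Γ) (hγ1 : γ ≠ 1) (hr : ratio γ = 1) {g : HypFour ≃ᵢ HypFour}
    (hg : g ∈ stabInfty Γ) : ratio g = 1 := by
  have h1 := not_ratio_lt_one hdisc hfree hγ hγ1 hr hg
  have h2 := not_ratio_lt_one hdisc hfree hγ hγ1 hr ((stabInfty Γ).inv_mem hg)
  have h3 : ratio g * ratio g⁻¹ = 1 := by rw [← ratio_mul hg.2, mul_inv_cancel, ratio_one]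
  push Not at h1 h2
  nlinarith

/-- The action of the stabilizer of `∞` on `ℝ³`, when it consists of isometries. -/
noncomputable def traceHom (Γ : Subgroup (HypFour ≃ᵢ HypFour))
    (h : ∀ g ∈ stabInfty Γ, ratio g = 1) :
    stabInfty Γ →* (EuclideanSpace ℝ (Fin 3) ≃ᵃⁱ[ℝ] EuclideanSpace ℝ (Fin 3)) where
  toFun g := IsometryEquiv.toRealAffineIsometryEquiv
    { toFun := trace g
      invFun := trace (g⁻¹ : stabInfty Γ)
      left_inv := fun v => by
        rw [← trace_mul (g⁻¹).2.2, ← Subgroup.coe_mul, inv_mul_cancel]; rfl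
      right_inv := fun v => by
        rw [← trace_mul g.2.2, ← Subgroup.coe_mul, mul_inv_cancel]; rfl
      isometry_toFun := Isometry.of_dist_eq fun v w => by
        rw [dist_eq_norm, dist_eq_norm, norm_trace_sub g.2.2, h g g.2, one_mul] }
  map_one' := by ext1 v; exact trace_one v
  map_mul' g k := by ext1 v; exact trace_mul g.2.2 k v

end HypFour

/-! ### Proof of the theorem. -/

theorem mainTheorem4 (Γ : Subgroup (HypFour ≃ᵢ HypFour))
    (hor : ∀ γ ∈ Γ, HypFour.OrientationPreserving γ)
    (hdisc : DiscreteTopology Γ)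
    (hfree : ∀ γ ∈ Γ, γ ≠ 1 → ∀ x : HypFour, γ x ≠ x)
    (hscrew : ∃ γ ∈ HypFour.stabInfty Γ, HypFour.IsIrrationalScrewTranslation γ) :
    IsCyclic (HypFour.stabInfty Γ) ∧ Infinite (HypFour.stabInfty Γ) := by
  open HypFour in
  obtain ⟨γ, hγ, hpar, h, -, A, a, -, hA, hN⟩ := hscrew
  have hr := ratio_eq_one_of_conj hγ.2 hN
  have hγ1 : γ ≠ 1 := by
    rintro rfl
    exact hpar.1 base rfl
  have hratio : ∀ g ∈ stabInfty Γ, ratio g = 1 := fun g hg =>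
    ratio_eq_one hdisc hfree hγ hγ1 hr hg
  -- If a power had trivial linear part, it would be a Euclidean translation, which an
  -- infinite-order rotation part excludes.
  have hinf : ∀ n, 0 < n → linearPart (traceHom Γ hratio ⟨γ, hγ⟩) ^ n ≠ 1 := by
    intro n hn h1
    rw [← map_pow, ← map_pow] at h1
    have hγn := (stabInfty Γ).pow_mem hγ n
    refine not_translation_of_conj hA hN hn (c := trace (γ ^ n) 0) fun x => ⟨?_, ?_⟩
    · rw [v_apply hγn.2]
      have e := apply_add_linearPart (traceHom Γ hratio (⟨γ, hγ⟩ ^ n)) 0 x.v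
      rw [h1, zero_add] at e
      rw [add_comm]
      exact e
    · rw [height_apply hγn.2, hratio _ hγn, one_mul]
  refine ⟨isCyclic_of_infinite_order (by simp) (traceHom Γ hratio) (fun g v hv => ?_)
    (fun R => ?_) hinf, ?_⟩
  · by_contra hne
    exact hfree g g.2.1 (fun h => hne (Subtype.ext h)) _
      (apply_eq_of_trace_eq g.2.2 (hratio g g.2) hv)
  -- At height one, Euclidean displacement `R` is hyperbolic distance `arcosh (1 + R² / 2)`.
  · have hfin := finite_displacement_le hdisc (lift 0) (Real.arcosh (1 + R ^ 2 / 2))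
    refine (hfin.preimage (f := Subtype.val) Subtype.val_injective.injOn).subset fun g hg => ?_
    refine ⟨g.2.1, ?_⟩
    have hle : (1 : ℝ) ≤ 1 + R ^ 2 / 2 := by nlinarith [sq_nonneg R]
    rw [← abs_of_nonneg (dist_nonneg (x := g.1 (lift 0))),
      ← abs_of_nonneg (Real.arcosh_nonneg hle), ← Real.cosh_le_cosh, Real.cosh_arcosh hle,
      cosh_dist_of_height_eq (by rw [height_apply g.2.2, hratio g g.2, one_mul])]
    have hg : ‖trace g 0‖ ≤ R := hg
    have h1 : ‖(g.1 (lift 0)).v - (lift 0).v‖ ≤ R := by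
      rw [show (lift 0).v = 0 from rfl, sub_zero]; exact hg
    have h2 : ‖(g.1 (lift 0)).v - (lift 0).v‖ ^ 2 ≤ R ^ 2 := by gcongr
    rw [show (lift 0).t = 1 from rfl]
    linarith
  · have hpow : Function.Injective fun n : ℕ => (⟨γ, hγ⟩ : stabInfty Γ) ^ n := by
      rw [injective_pow_iff_not_isOfFinOrder, isOfFinOrder_iff_pow_eq_one]
      rintro ⟨n, hn, h1⟩
      apply hinf n hn
      rw [← map_pow, ← map_pow, h1, map_one, map_one]
    exact Infinite.of_injective _ hpow
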